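/- For a finite simple undirected graph $G$ with $n$ vertices, a feedback vertex set is a set $S\subseteq V(G)$ such that $G-S$ is a forest; it is minimal if no proper subset of $S$ is a feedback vertex set. Let $\mathsf{opt}(G)$ be the maximum size of a minimal feedback vertex set of $G$ and $\mathsf{vc}(G)$ the minimum size of a vertex cover of $G$. For every fixed $\epsilon>0$ there is an algorithm that, given $G$, runs in time $2^{O(\mathsf{vc}(G)/\epsilon)}\,n^{O(1)}$ and returns a minimal feedback vertex set of $G$ of size at least $(1-\epsilon)\,\mathsf{opt}(G)$. The constants hidden in the $O$-notation do not depend on $\epsilon$ or $G$. (Running time is counted as the number of steps of a deterministic random access machine with unit-cost addition, truncated subtraction and memory access, on the adjacency matrix of $G$; the bound is read as $2^{c\,\mathsf{vc}(G)/\epsilon}(n+2)^{d}$ with absolute constants $c,d$.) -/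

import Mathlib

namespace MaxMinFVS

/-! ### Minimal feedback vertex sets -/

section Graphs

variable {V : Type*} [Fintype V]

/-- `S` is a feedback vertex set of `G`: the graph `G - S` is a forest. -/
def IsFVS (G : SimpleGraph V) (S : Finset V) : Prop :=
  (G.induce {v : V | v ∉ S}).IsAcyclic

/-- `S` is a minimal feedback vertex set: it is a feedback vertex set, and no proper subset of it
is one. -/
def IsMinimalFVS (G : SimpleGraph V) (S : Finset V) : Prop :=
  Minimal (IsFVS G) S

open Classical in
/-- `opt(G)`: the maximum size of a minimal feedback vertex set of `G`. -/
noncomputable def opt (G : SimpleGraph V) : ℕ :=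
  (Finset.univ.filter (fun S : Finset V => IsMinimalFVS G S)).sup Finset.card

/-- `vc(G)`: the minimum size of a vertex cover of the finite graph `G`, as a natural number. -/
noncomputable def vc (G : SimpleGraph V) : ℕ :=
  G.vertexCoverNum.toNat

end Graphs

/-! ### A random access machine with a step count

A deterministic RAM with finitely many registers used by each program, an unbounded memory that is
addressed indirectly, and structured control flow. The only arithmetic operations are addition and
truncated subtraction; these and memory accesses have unit cost (so in time `t` only numbers with
`O(t)` bits more than the input numbers and program constants can be produced, and the model is
polynomially equivalent to Turing machines). -/

/-- A machine state: register contents and memory contents. -/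
structure State where
  reg : ℕ → ℕ
  mem : ℕ → ℕ

/-- Expressions: constants, registers, indirect memory access, addition, truncated subtraction. -/
inductive Expr where
  | const (k : ℕ)
  | var (i : ℕ)
  | load (addr : Expr)
  | add (a b : Expr)
  | sub (a b : Expr)

/-- The value of an expression in a state. -/
def Expr.eval (s : State) : Expr → ℕ
  | .const k => k
  | .var i => s.reg i
  | .load a => s.mem (a.eval s)
  | .add a b => a.eval s + b.eval s
  | .sub a b => a.eval s - b.eval s

/-- The cost of evaluating an expression: one unit for each operation and operand in it. -/
def Expr.cost : Expr → ℕ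
  | .const _ => 1
  | .var _ => 1
  | .load a => a.cost + 1
  | .add a b => a.cost + b.cost + 1
  | .sub a b => a.cost + b.cost + 1

/-- Programs. -/
inductive Prog where
  /-- Do nothing. -/
  | skip
  /-- Put the value of `e` into register `i`. -/
  | assign (i : ℕ) (e : Expr)
  /-- Put the value of `e` into the memory cell whose address is the value of `addr`. -/
  | store (addr e : Expr)
  /-- Sequential composition. -/
  | seq (p q : Prog)
  /-- Run `p` if the value of `b` is not zero, and `q` otherwise. -/
  | ite (b : Expr) (p q : Prog)
  /-- Repeat `p` as long as the value of `b` is not zero. -/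
  | while (b : Expr) (p : Prog)

/-- `Exec p s s' t`: started in state `s`, the program `p` halts in state `s'`, after exactly `t`
time steps. -/
inductive Exec : Prog → State → State → ℕ → Prop where
  | skip (s : State) : Exec .skip s s 1
  | assign (i : ℕ) (e : Expr) (s : State) :
      Exec (.assign i e) s ⟨Function.update s.reg i (e.eval s), s.mem⟩ (e.cost + 1)
  | store (addr e : Expr) (s : State) :
      Exec (.store addr e) s ⟨s.reg, Function.update s.mem (addr.eval s) (e.eval s)⟩
        (addr.cost + e.cost + 1)
  | seq {p q : Prog} {s s' s'' : State} {t t' : ℕ} (hp : Exec p s s' t) (hq : Exec q s' s'' t') :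
      Exec (.seq p q) s s'' (t + t')
  | ite_true {b : Expr} {p q : Prog} {s s' : State} {t : ℕ} (hb : b.eval s ≠ 0)
      (hp : Exec p s s' t) : Exec (.ite b p q) s s' (b.cost + 1 + t)
  | ite_false {b : Expr} {p q : Prog} {s s' : State} {t : ℕ} (hb : b.eval s = 0)
      (hq : Exec q s s' t) : Exec (.ite b p q) s s' (b.cost + 1 + t)
  | while_true {b : Expr} {p : Prog} {s s' s'' : State} {t t' : ℕ} (hb : b.eval s ≠ 0)
      (hp : Exec p s s' t) (hw : Exec (.while b p) s' s'' t') :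
      Exec (.while b p) s s'' (b.cost + 1 + t + t')
  | while_false {b : Expr} {p : Prog} {s : State} (hb : b.eval s = 0) :
      Exec (.while b p) s s (b.cost + 1)

/-- The machine is deterministic: the final state and the running time are determined by the
program and the initial state. -/
theorem Exec.deterministic {p : Prog} {s s₁ s₂ : State} {t₁ t₂ : ℕ}
    (h₁ : Exec p s s₁ t₁) (h₂ : Exec p s s₂ t₂) : s₁ = s₂ ∧ t₁ = t₂ := by
  induction h₁ generalizing s₂ t₂ with
  | skip | assign | store => cases h₂; exact ⟨rfl, rfl⟩
  | seq _ _ ihp ihq =>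
    cases h₂ with
    | seq hp hq =>
      obtain ⟨rfl, rfl⟩ := ihp hp
      obtain ⟨rfl, rfl⟩ := ihq hq
      exact ⟨rfl, rfl⟩
  | ite_true hb _ ih =>
    cases h₂ with
    | ite_true _ hp => obtain ⟨rfl, rfl⟩ := ih hp; exact ⟨rfl, rfl⟩
    | ite_false hb' _ => exact absurd hb' hb
  | ite_false hb _ ih =>
    cases h₂ with
    | ite_true hb' _ => exact absurd hb hb'
    | ite_false _ hq => obtain ⟨rfl, rfl⟩ := ih hq; exact ⟨rfl, rfl⟩
  | while_true hb _ _ ihp ihw =>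
    cases h₂ with
    | while_true _ hp hw =>
      obtain ⟨rfl, rfl⟩ := ihp hp
      obtain ⟨rfl, rfl⟩ := ihw hw
      exact ⟨rfl, rfl⟩
    | while_false hb' => exact absurd hb' hb
  | while_false hb =>
    cases h₂ with
    | while_true hb' _ _ => exact absurd hb hb'
    | while_false _ => exact ⟨rfl, rfl⟩

open Classical in
/-- The initial state for the input graph `G` on the vertices `0, …, n - 1`: register `0` holds `n`,
the memory cells `0, …, n * n - 1` hold the adjacency matrix of `G` row by row, and everything else
is `0`. -/
noncomputable def inputState {n : ℕ} (G : SimpleGraph (Fin n)) : State where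
  reg i := if i = 0 then n else 0
  mem a := if ∃ u v : Fin n, a = u * n + v ∧ G.Adj u v then 1 else 0

/-- The set of vertices that a final state returns: the vertices `v` for which memory cell `v` is
not zero. -/
def outputSet (n : ℕ) (s : State) : Finset (Fin n) :=
  Finset.univ.filter (fun v : Fin n => s.mem v ≠ 0)

end MaxMinFVS

/-! Complements of minimal feedback vertex sets are exactly the maximal induced forests, so the task
is to find a maximal induced forest `F` with large complement. A greedy maximal matching of size `m
≤ vc G` has `2 * m` endpoints. They form a vertex cover `C`, and outside `C` the graph has no edges.

Let `A = F ∩ C`, and let `J` be the set of vertices outside `C` with at least two neighbours in `A`.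
A vertex outside `C` with at most one neighbour in `A` closes no cycle, so maximality puts it into
`F`. Hence `A` and `F ∩ J` determine `F`, and `|C| + |J|` bits describe it. The algorithm runs
through all codes below `2 ^ (|C| * (k + 2))` with `k` about `1 / ε`. It decodes each one greedily,
never leaving the class of induced forests, extends the result to a maximal forest and keeps the one
with the largest complement.

For an optimal `F` there are two cases (`mul_opt_le_of_search`). If `|J| ≤ |C| * (k + 1)`, its full
code is in range and `F` itself is found. Otherwise the code of `A` alone is in range and yields a
maximal forest `F₁` containing `A`. At most `|A|` vertices of `J` fit into `F₁`, because each brings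
two edges into a forest on them and `A` (`card_le_of_two_le_card_filter_adj`). So `F₁` leaves out at
least `|J| - |A|` vertices, which is within `|C|` of the optimum, while the optimum is at least `k *
|C|`. The loss is a fraction of at most `1 / k`.

For the running time, the algorithm is written in a language of bounded loops whose compilation to
the machine is verified once (`Cmd.exec_compile`). In the search every loop bound is at most `max n
P`, with `P = 2 ^ (m * D)` the number of codes, and the nesting depth is an absolute constant. The
time is therefore polynomial in `n` and `P`, and `m * D = O(vc G / ε)`. -/

namespace MaxMinFVS

/-! ### Induced forests and minimal feedback vertex sets -/

section Forests

variable {V : Type*}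

/-- The subgraph of `G` induced on `F`, as a graph on all the vertices. -/
def restrict (G : SimpleGraph V) (F : Finset V) : SimpleGraph V where
  Adj u v := G.Adj u v ∧ u ∈ F ∧ v ∈ F
  symm := ⟨fun _ _ h => ⟨h.1.symm, h.2.2, h.2.1⟩⟩
  loopless := ⟨fun _ h => G.irrefl h.1⟩

/-- `G[F]` is a forest. -/
def InducesForest (G : SimpleGraph V) (F : Finset V) : Prop :=
  (restrict G F).IsAcyclic

/-- `F` is a vertex set inducing a forest which no further vertex can join. -/
def IsMaxForest [DecidableEq V] (G : SimpleGraph V) (F : Finset V) : Prop :=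
  InducesForest G F ∧ ∀ v ∉ F, ¬ InducesForest G (insert v F)

theorem restrict_mono (G : SimpleGraph V) {F F' : Finset V} (h : F ⊆ F') :
    restrict G F ≤ restrict G F' :=
  fun _ _ huv => ⟨huv.1, h huv.2.1, h huv.2.2⟩

theorem InducesForest.anti {G : SimpleGraph V} {F F' : Finset V} (h : F ⊆ F')
    (hF : InducesForest G F') : InducesForest G F :=
  SimpleGraph.IsAcyclic.anti (restrict_mono G h) hF

theorem inducesForest_empty (G : SimpleGraph V) : InducesForest G ∅ := by
  have : restrict G ∅ = ⊥ := by
    ext u v; simp [restrict]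
  rw [InducesForest, this]
  exact SimpleGraph.isAcyclic_bot

/-- The two graphs differ only by isolated vertices: every vertex on a cycle of `restrict G F` is an
endpoint of one of its edges and so lies in `F`. -/
theorem inducesForest_iff_induce (G : SimpleGraph V) (F : Finset V) :
    InducesForest G F ↔ (G.induce {v : V | v ∈ F}).IsAcyclic := by
  constructor
  · intro h
    refine SimpleGraph.IsAcyclic.comap (G' := restrict G F) ⟨Subtype.val, ?_⟩
      Subtype.val_injective h
    intro a b hab
    exact ⟨hab, a.2, b.2⟩
  · intro h v c hc
    have hle : restrict G F ≤ G := fun _ _ h => h.1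
    have hsupp : ∀ x ∈ (c.mapLe hle).support, x ∈ {v : V | v ∈ F} := by
      intro x hx
      simp only [SimpleGraph.Walk.support_mapLe_eq_support] at hx
      obtain ⟨e, he, hxe⟩ := SimpleGraph.Walk.mem_support_iff_exists_mem_edges_of_not_nil
        hc.not_nil |>.1 hx
      have he' := c.edges_subset_edgeSet he
      induction e with
      | h a b =>
        have hab : (restrict G F).Adj a b := he'
        rcases Sym2.mem_iff.1 hxe with rfl | rfl
        · exact hab.2.1
        · exact hab.2.2
    have hc' : (c.mapLe hle).IsCycle := hc.mapLe _
    have := SimpleGraph.Walk.map_induce _ hsupp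
    rw [← this] at hc'
    exact h _ ((SimpleGraph.Walk.isCycle_map_iff_of_injective
      (SimpleGraph.Embedding.induce (G := G) {v : V | v ∈ F}).injective).1 hc')

theorem isFVS_iff [Fintype V] [DecidableEq V] (G : SimpleGraph V) (S : Finset V) :
    IsFVS G S ↔ InducesForest G Sᶜ := by
  rw [inducesForest_iff_induce]
  rw [IsFVS, show {v : V | v ∈ Sᶜ} = {v : V | v ∉ S} by ext; simp]

/-- Induced forests are closed under subsets, so minimality needs to be tested only against the
removal of a single vertex. -/
theorem isMinimalFVS_iff [Fintype V] [DecidableEq V] (G : SimpleGraph V) (S : Finset V) :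
    IsMinimalFVS G S ↔ IsMaxForest G Sᶜ := by
  constructor
  · rintro ⟨h1, h2⟩
    refine ⟨(isFVS_iff G S).1 h1, fun v hv hf => ?_⟩
    have hv' : v ∈ S := by simpa using hv
    have : IsFVS G (S.erase v) := by
      rw [isFVS_iff, Finset.compl_erase]
      exact hf
    exact Finset.notMem_erase v S (h2 this (Finset.erase_subset v S) hv')
  · rintro ⟨h1, h2⟩
    refine ⟨(isFVS_iff G S).2 h1, fun T hT hTS v hv => ?_⟩
    by_contra hvT
    refine h2 v (by simpa using hv) (InducesForest.anti ?_ ((isFVS_iff G T).1 hT))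
    intro x hx
    rcases Finset.mem_insert.1 hx with rfl | hx
    · simpa using hvT
    · have : x ∉ S := by simpa using hx
      simpa using fun h => this (hTS h)

theorem exists_isMaxForest_card_eq_opt [Fintype V] [DecidableEq V] (G : SimpleGraph V) :
    ∃ F : Finset V, IsMaxForest G F ∧ Fᶜ.card = opt G := by
  classical
  have hne : (Finset.univ.filter (fun S : Finset V => IsMinimalFVS G S)).Nonempty := by
    obtain ⟨S, -, hS⟩ := exists_minimal_le_of_wellFoundedLT (IsFVS G) (Finset.univ : Finset V)
      ((isFVS_iff G _).2 (by simpa using inducesForest_empty G))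
    exact ⟨S, Finset.mem_filter.2 ⟨Finset.mem_univ _, hS⟩⟩
  obtain ⟨S, hS, hc⟩ := Finset.exists_mem_eq_sup _ hne Finset.card
  refine ⟨Sᶜ, (isMinimalFVS_iff G S).1 (by simpa using hS), ?_⟩
  rw [compl_compl, opt, hc]

theorem IsMaxForest.card_le_opt [Fintype V] [DecidableEq V] {G : SimpleGraph V} {F : Finset V}
    (hF : IsMaxForest G F) : Fᶜ.card ≤ opt G := by
  classical
  unfold opt
  exact Finset.le_sup (f := Finset.card) (by simp [isMinimalFVS_iff, hF])

theorem exists_vertexCover_card_eq_vc [Fintype V] (G : SimpleGraph V) :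
    ∃ X : Finset V, (∀ u v, G.Adj u v → u ∈ X ∨ v ∈ X) ∧ X.card = vc G := by
  classical
  obtain ⟨s, hs, hc⟩ := SimpleGraph.vertexCoverNum_exists G
  refine ⟨s.toFinset, fun u v h => by simpa using hc h, ?_⟩
  rw [vc, ← hs, Set.encard_eq_coe_toFinset_card, ENat.toNat_natCast]

/-- The new vertex is isolated or a leaf. In the second case its one edge joins it to a component
that does not contain it, so no cycle appears. -/
theorem inducesForest_insert_of_card_le_one [DecidableEq V] {G : SimpleGraph V}
    [DecidableRel G.Adj] {F : Finset V} (hF : InducesForest G F) {v : V}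
    (hv : (F.filter (G.Adj v)).card ≤ 1) : InducesForest G (insert v F) := by
  by_cases hvF : v ∈ F
  · rwa [Finset.insert_eq_of_mem hvF]
  by_cases h : ∃ w ∈ F, G.Adj v w
  · obtain ⟨w, hw, hvw⟩ := h
    have huniq : ∀ x ∈ F, G.Adj v x → x = w := fun x hx hvx =>
      Finset.card_le_one.1 hv x (by simp [hx, hvx]) w (by simp [hw, hvw])
    have hr : ¬ (restrict G F).Reachable v w := by
      intro hr
      obtain ⟨x, hx⟩ := SimpleGraph.mem_support_of_reachable hvw.ne hr
      exact hvF hx.2.1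
    refine SimpleGraph.IsAcyclic.anti ?_ (hF.sup_edge_of_not_reachable hr)
    intro a b hab
    rw [SimpleGraph.sup_adj, SimpleGraph.edge_adj]
    obtain ⟨hG, ha, hb⟩ := hab
    rcases Finset.mem_insert.1 ha with rfl | ha' <;> rcases Finset.mem_insert.1 hb with rfl | hb'
    · exact absurd hG (G.irrefl)
    · exact Or.inr ⟨Or.inl ⟨rfl, huniq b hb' hG⟩, hG.ne⟩
    · exact Or.inr ⟨Or.inr ⟨huniq a ha' hG.symm, rfl⟩, hG.ne⟩
    · exact Or.inl ⟨hG, ha', hb'⟩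
  · push Not at h
    refine SimpleGraph.IsAcyclic.anti ?_ hF
    intro a b hab
    obtain ⟨hG, ha, hb⟩ := hab
    rcases Finset.mem_insert.1 ha with rfl | ha' <;> rcases Finset.mem_insert.1 hb with rfl | hb'
    · exact absurd hG (G.irrefl)
    · exact absurd hG (h b hb')
    · exact absurd hG.symm (h a ha')
    · exact ⟨hG, ha', hb'⟩

theorem card_edgeSet_le_card [Finite V] {H : SimpleGraph V} (hH : H.IsAcyclic) :
    Nat.card H.edgeSet ≤ Nat.card V := by
  classical
  have := Fintype.ofFinite V
  cases isEmpty_or_nonempty V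
  · have : H.edgeSet = ∅ := by
      ext e; induction e with | h a b => exact isEmptyElim a
    simp [this]
  -- The forest extends to a spanning tree of the complete graph, which has `|V| - 1` edges.
  · obtain ⟨T, hHT, -, hT⟩ := SimpleGraph.Connected.exists_isTree_le_of_le_of_isAcyclic
      (G := (⊤ : SimpleGraph V)) SimpleGraph.connected_top le_top hH
    have h1 := hT.card_edgeFinset
    have h2 : Nat.card H.edgeSet ≤ Nat.card T.edgeSet :=
      Nat.card_mono (Set.toFinite _) (SimpleGraph.edgeSet_mono hHT)
    rw [Nat.card_eq_fintype_card (α := T.edgeSet), ← SimpleGraph.edgeFinset_card] at h2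
    rw [Nat.card_eq_fintype_card (α := V)]
    omega

/-- In a forest, at most `|A|` vertices outside `A` have two neighbours in `A`. -/
theorem card_le_of_two_le_card_filter_adj [DecidableEq V] {G : SimpleGraph V}
    [DecidableRel G.Adj] {A T : Finset V} (hF : InducesForest G (A ∪ T)) (hd : Disjoint A T)
    (h2 : ∀ t ∈ T, 2 ≤ (A.filter (G.Adj t)).card) : T.card ≤ A.card := by
  classical
  -- Two edges from each `t` into `A` are chosen, indexed by `Bool`. They inject `T × Bool` into the
  -- edges of a forest on `|A| + |T|` vertices, so `2 * |T| ≤ |A| + |T|`.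
  have hex : ∀ t : T, ∃ f : Bool → V, Function.Injective f ∧ ∀ i, f i ∈ A ∧ G.Adj t (f i) := by
    intro t
    obtain ⟨x, y, hx, hy, hxy⟩ := Finset.one_lt_card_iff.1 (h2 t t.2)
    refine ⟨fun i => if i then x else y, ?_, ?_⟩
    · intro i j
      cases i <;> cases j <;> simp [hxy, hxy.symm]
    · intro i
      cases i <;> simp_all
  choose f hf1 hf2 using hex
  rw [inducesForest_iff_induce] at hF
  have hE := card_edgeSet_le_card hF
  have hV : Nat.card {v : V | v ∈ A ∪ T} = A.card + T.card := by
    rw [← Finset.card_union_of_disjoint hd, Nat.card_coe_set_eq, ← Set.ncard_coe_finset]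
    rfl
  let g : T × Bool → (G.induce {v : V | v ∈ A ∪ T}).edgeSet := fun p =>
    ⟨s(⟨p.1, Finset.mem_union_right _ p.1.2⟩,
      ⟨f p.1 p.2, Finset.mem_union_left _ (hf2 p.1 p.2).1⟩), (hf2 p.1 p.2).2⟩
  have hg : Function.Injective g := by
    rintro ⟨t, i⟩ ⟨t', i'⟩ h
    have h' := congrArg Subtype.val h
    simp only [g, Sym2.eq_iff, Subtype.mk.injEq] at h'
    rcases h' with ⟨h1, h2⟩ | ⟨h1, -⟩
    · obtain rfl := Subtype.ext h1
      rw [hf1 t h2]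
    · exact absurd (h1 ▸ t.2) (Finset.disjoint_left.1 hd (hf2 t' i').1)
  have := Nat.card_le_card_of_injective g hg
  rw [Nat.card_prod, Nat.card_eq_fintype_card (α := T), Fintype.card_coe,
    Nat.card_eq_fintype_card (α := Bool), Fintype.card_bool] at this
  omega

theorem filter_adj_inter_eq [DecidableEq V] {G : SimpleGraph V} [DecidableRel G.Adj]
    {C : Finset V} (hC : ∀ u v, G.Adj u v → u ∈ C ∨ v ∈ C) {v : V}
    (hv : v ∉ C) (F : Finset V) : (F ∩ C).filter (G.Adj v) = F.filter (G.Adj v) := by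
  ext u
  simp only [Finset.mem_filter, Finset.mem_inter]
  have := hC v u
  tauto

end Forests

/-! ### Bounds for the complement of a forest in terms of its trace on a vertex cover -/

section MaxForests

variable {V : Type*} [Fintype V] [DecidableEq V] {G : SimpleGraph V} [DecidableRel G.Adj]

/-- The vertices outside `C` with at least two neighbours in `A`. -/
def branchVertices (G : SimpleGraph V) [DecidableRel G.Adj] (C A : Finset V) : Finset V :=
  Finset.univ.filter (fun v => v ∉ C ∧ 2 ≤ (A.filter (G.Adj v)).card)

/-- A vertex outside both `C` and `F` must have two neighbours in `F`, since otherwise it could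
join. These neighbours lie in `C` because `C` covers all edges. -/
theorem IsMaxForest.card_compl_le {C F : Finset V} (hC : ∀ u v, G.Adj u v → u ∈ C ∨ v ∈ C)
    (hF : IsMaxForest G F) :
    Fᶜ.card ≤ (C \ (F ∩ C)).card + (branchVertices G C (F ∩ C)).card := by
  refine le_trans (Finset.card_le_card ?_) (Finset.card_union_le _ _)
  intro v hv
  have hvF : v ∉ F := by simpa using hv
  by_cases hvC : v ∈ C
  · simp [hvC, hvF]
  · simp only [Finset.mem_union, branchVertices, Finset.mem_filter, Finset.mem_univ, true_and]
    refine Or.inr ⟨hvC, ?_⟩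
    rw [filter_adj_inter_eq hC hvC]
    by_contra hlt
    exact hF.2 v hvF (inducesForest_insert_of_card_le_one hF.1 (by omega))

/-- The branch vertices inside `F` together with `A` span a forest, so there are at most `|A|` of
them. The bound holds for any forest containing `A`, and is applied to one that may differ from the
optimum. -/
theorem InducesForest.card_branchVertices_le {C A F : Finset V} (hA : A ⊆ F) (hAC : A ⊆ C)
    (hF : InducesForest G F) : (branchVertices G C A).card ≤ Fᶜ.card + A.card := by
  have h1 : (branchVertices G C A ∩ F).card ≤ A.card := by
    refine card_le_of_two_le_card_filter_adj (G := G) (hF.anti ?_) ?_ ?_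
    · exact Finset.union_subset hA Finset.inter_subset_right
    · rw [Finset.disjoint_left]
      intro x hx hx'
      simp only [branchVertices, Finset.mem_inter, Finset.mem_filter] at hx'
      exact hx'.1.2.1 (hAC hx)
    · intro t ht
      simp only [branchVertices, Finset.mem_inter, Finset.mem_filter] at ht
      exact ht.1.2.2
  have h2 : branchVertices G C A ⊆ Fᶜ ∪ (branchVertices G C A ∩ F) := by
    intro x hx
    by_cases hxF : x ∈ F <;> simp [hx, hxF]
  have := (Finset.card_le_card h2).trans (Finset.card_union_le _ _)
  omega

end MaxForests

/-! ### Components and acyclicity as edges are added one at a time -/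

section EdgeByEdge

variable {n : ℕ}

/-- The edges of `R` from a vertex `u` down to a smaller vertex `v`, for `(u, v)` before `(a, b)`
in the lexicographic order. -/
def edgesBefore (R : SimpleGraph (Fin n)) (a b : ℕ) : SimpleGraph (Fin n) where
  Adj u v := R.Adj u v ∧ ((v < u ∧ (u.1 < a ∨ u.1 = a ∧ v.1 < b)) ∨
    (u < v ∧ (v.1 < a ∨ v.1 = a ∧ u.1 < b)))
  symm := ⟨fun _ _ h => ⟨h.1.symm, h.2.symm⟩⟩
  loopless := ⟨fun _ h => R.irrefl h.1⟩

theorem edgesBefore_le (R : SimpleGraph (Fin n)) (a b : ℕ) : edgesBefore R a b ≤ R :=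
  fun _ _ h => h.1

theorem edgesBefore_zero (R : SimpleGraph (Fin n)) : edgesBefore R 0 0 = ⊥ := by
  ext u v; simp [edgesBefore]

theorem edgesBefore_last (R : SimpleGraph (Fin n)) : edgesBefore R n 0 = R := by
  ext u v
  simp only [edgesBefore]
  have := u.2
  have := v.2
  constructor
  · exact fun h => h.1
  · intro h
    refine ⟨h, ?_⟩
    have := h.ne
    omega

theorem edgesBefore_row (R : SimpleGraph (Fin n)) (a : ℕ) :
    edgesBefore R a n = edgesBefore R (a + 1) 0 := by
  ext u v
  simp only [edgesBefore]
  have := u.2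
  have := v.2
  refine and_congr_right fun _ => ?_
  omega

theorem edgesBefore_succ_of_not {R : SimpleGraph (Fin n)} {a b : Fin n}
    (h : ¬ (b < a ∧ R.Adj a b)) : edgesBefore R a (b + 1) = edgesBefore R a b := by
  ext u v
  simp only [edgesBefore]
  refine and_congr_right fun huv => ?_
  have h1 : ¬ (u = a ∧ v = b ∧ b < a) := by rintro ⟨rfl, rfl, h'⟩; exact h ⟨h', huv⟩
  have h2 : ¬ (v = a ∧ u = b ∧ b < a) := by rintro ⟨rfl, rfl, h'⟩; exact h ⟨h', huv.symm⟩
  omega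

theorem edgesBefore_succ {R : SimpleGraph (Fin n)} {a b : Fin n} (hba : b < a)
    (hR : R.Adj a b) : edgesBefore R a (b + 1) = edgesBefore R a b ⊔ SimpleGraph.edge a b := by
  ext u v
  rw [SimpleGraph.sup_adj, SimpleGraph.edge_adj]
  simp only [edgesBefore]
  constructor
  · rintro ⟨huv, h⟩
    have := huv.ne
    by_cases h1 : u = a ∧ v = b
    · tauto
    by_cases h2 : v = a ∧ u = b
    · tauto
    left
    refine ⟨huv, ?_⟩
    omega
  · rintro (⟨h1, h2⟩ | ⟨⟨rfl, rfl⟩ | ⟨rfl, rfl⟩, h2⟩)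
    · exact ⟨h1, by omega⟩
    · exact ⟨hR, by omega⟩
    · exact ⟨hR.symm, by omega⟩

theorem not_edgesBefore_adj {R : SimpleGraph (Fin n)} {a b : Fin n} :
    ¬ (edgesBefore R a b).Adj a b := by
  simp only [edgesBefore]
  omega

/-- A walk either avoids the new edge or can be shortened to cross it once, in one of its two
directions. -/
theorem reachable_sup_edge_iff {V : Type*} (H : SimpleGraph V) {a b : V} (hab : a ≠ b) (u v : V) :
    (H ⊔ SimpleGraph.edge a b).Reachable u v ↔
      H.Reachable u v ∨ (H.Reachable u a ∧ H.Reachable b v) ∨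
        (H.Reachable u b ∧ H.Reachable a v) := by
  have hle : H ≤ H ⊔ SimpleGraph.edge a b := le_sup_left
  have hadj : (H ⊔ SimpleGraph.edge a b).Reachable a b :=
    SimpleGraph.Adj.reachable (by simp [SimpleGraph.sup_adj, SimpleGraph.edge_adj, hab])
  constructor
  · rintro ⟨p⟩
    induction p with
    | nil => exact Or.inl (SimpleGraph.Reachable.refl _)
    | @cons x y z h p ih =>
      rw [SimpleGraph.sup_adj, SimpleGraph.edge_adj] at h
      rcases h with h | ⟨⟨rfl, rfl⟩ | ⟨rfl, rfl⟩, -⟩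
      · have hxy := h.reachable
        rcases ih with h1 | ⟨h1, h2⟩ | ⟨h1, h2⟩
        · exact Or.inl (hxy.trans h1)
        · exact Or.inr (Or.inl ⟨hxy.trans h1, h2⟩)
        · exact Or.inr (Or.inr ⟨hxy.trans h1, h2⟩)
      · rcases ih with h1 | ⟨h1, h2⟩ | ⟨h1, h2⟩
        · exact Or.inr (Or.inl ⟨SimpleGraph.Reachable.refl _, h1⟩)
        · exact Or.inr (Or.inl ⟨SimpleGraph.Reachable.refl _, h2⟩)
        · exact Or.inl h2
      · rcases ih with h1 | ⟨h1, h2⟩ | ⟨h1, h2⟩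
        · exact Or.inr (Or.inr ⟨SimpleGraph.Reachable.refl _, h1⟩)
        · exact Or.inl h2
        · exact Or.inr (Or.inr ⟨SimpleGraph.Reachable.refl _, h2⟩)
  · rintro (h | ⟨h1, h2⟩ | ⟨h1, h2⟩)
    · exact h.mono hle
    · exact ((h1.mono hle).trans hadj).trans (h2.mono hle)
    · exact ((h1.mono hle).trans hadj.symm).trans (h2.mono hle)

/-- `comp` labels the components of `H`. -/
def LabelsComponents (comp : ℕ → ℕ) (H : SimpleGraph (Fin n)) : Prop :=
  ∀ u v : Fin n, comp u = comp v ↔ H.Reachable u v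

theorem labelsComponents_bot : LabelsComponents (fun u => u) (⊥ : SimpleGraph (Fin n)) := by
  intro u v
  simp [SimpleGraph.reachable_bot, Fin.ext_iff]

theorem LabelsComponents.sup_edge {comp : ℕ → ℕ} {H : SimpleGraph (Fin n)}
    (h : LabelsComponents comp H) {a b : Fin n} (hab : a ≠ b) {comp' : ℕ → ℕ}
    (hc : ∀ u : Fin n, comp' u = if comp u = comp a then comp b else comp u) :
    LabelsComponents comp' (H ⊔ SimpleGraph.edge a b) := by
  intro u v
  rw [reachable_sup_edge_iff H hab, hc, hc, ← h, ← h, ← h, ← h, ← h]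
  split_ifs <;> grind

end EdgeByEdge


/-! ### A language of bounded loops over arrays, compiled to the machine -/

/-- States of the array language: registers and eight arrays. -/
structure AState where
  reg : ℕ → ℕ
  arr : Fin 8 → ℕ → ℕ

/-- Write `x` into register `r`. -/
def AState.setReg (σ : AState) (r x : ℕ) : AState :=
  ⟨fun r' => if r' = r then x else σ.reg r', σ.arr⟩

/-- Write `x` into entry `i` of array `a`. -/
def AState.setArr (σ : AState) (a : Fin 8) (i x : ℕ) : AState :=
  ⟨σ.reg, fun a' => if a' = a then fun i' => if i' = i then x else σ.arr a i' else σ.arr a'⟩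

@[simp] theorem AState.setReg_reg (σ : AState) (r x r' : ℕ) :
    (σ.setReg r x).reg r' = if r' = r then x else σ.reg r' := rfl
@[simp] theorem AState.setReg_arr (σ : AState) (r x : ℕ) : (σ.setReg r x).arr = σ.arr := rfl
@[simp] theorem AState.setArr_reg (σ : AState) (a : Fin 8) (i x : ℕ) :
    (σ.setArr a i x).reg = σ.reg := rfl
@[simp] theorem AState.setArr_arr (σ : AState) (a : Fin 8) (i x : ℕ) (a' : Fin 8) :
    (σ.setArr a i x).arr a' =
      if a' = a then fun i' => if i' = i then x else σ.arr a i' else σ.arr a' := rfl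

/-- Expressions of the array language; `inp e` reads the input. -/
inductive AExpr where
  | const (k : ℕ)
  | var (i : ℕ)
  | get (a : Fin 8) (e : AExpr)
  | inp (e : AExpr)
  | add (a b : AExpr)
  | sub (a b : AExpr)

/-- The value of an expression on the input `inp`. -/
def AExpr.eval (inp : ℕ → ℕ) (σ : AState) : AExpr → ℕ
  | .const k => k
  | .var i => σ.reg i
  | .get a e => σ.arr a (e.eval inp σ)
  | .inp e => inp (e.eval inp σ)
  | .add a b => a.eval inp σ + b.eval inp σ
  | .sub a b => a.eval inp σ - b.eval inp σ

/-- Twice the value of an expression. -/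
def Expr.double (e : Expr) : Expr := .add e e

/-- The address of entry `e` of array `a`; machine register `0` holds the size of the input. -/
def arrayAddr (a : Fin 8) (e : Expr) : Expr :=
  .add (.add (.var 0) (.const (1 + a))) e.double.double.double

/-- Compiled expressions. -/
def AExpr.compile : AExpr → Expr
  | .const k => .const k
  | .var i => .var (i + 1)
  | .get a e => .load (arrayAddr a e.compile)
  | .inp e => .load (.sub e.compile (.sub e.compile (.var 0)))
  | .add a b => .add a.compile b.compile
  | .sub a b => .sub a.compile b.compile

/-- Commands of the array language. `loop i b c` runs `c` with register `i` ranging over the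
numbers below the value of register `b`. -/
inductive Cmd where
  | set (r : ℕ) (e : AExpr)
  | put (a : Fin 8) (i e : AExpr)
  | seq (c d : Cmd)
  | ite (b : AExpr) (c d : Cmd)
  | loop (i b : ℕ) (c : Cmd)
  | skip

infixr:60 " ;; " => Cmd.seq

/-- `k` rounds of a loop with index register `i` and body semantics `f`. -/
def iterate (f : AState → AState) (i : ℕ) (σ : AState) : ℕ → AState
  | 0 => σ
  | k + 1 => f ((iterate f i σ k).setReg i k)

/-- The final state of a command. -/
def Cmd.den (inp : ℕ → ℕ) : Cmd → AState → AState
  | .set r e, σ => σ.setReg r (e.eval inp σ)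
  | .put a i e, σ => σ.setArr a (i.eval inp σ) (e.eval inp σ)
  | .seq c d, σ => d.den inp (c.den inp σ)
  | .ite b c d, σ => if b.eval inp σ ≠ 0 then c.den inp σ else d.den inp σ
  | .loop i b c, σ => (iterate (c.den inp) i σ (σ.reg b)).setReg i (σ.reg b)
  | .skip, σ => σ

/-- Compiled commands. -/
def Cmd.compile : Cmd → Prog
  | .set r e => .assign (r + 1) e.compile
  | .put a i e => .store (arrayAddr a i.compile) e.compile
  | .seq c d => .seq c.compile d.compile
  | .ite b c d => .ite b.compile c.compile d.compile
  | .loop i b c => .seq (.assign (i + 1) (.const 0))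
      (.while (.sub (.var (b + 1)) (.var (i + 1)))
        (.seq c.compile (.assign (i + 1) (.add (.var (i + 1)) (.const 1)))))
  | .skip => .skip

/-- `c` does not write register `r`. -/
def Cmd.noWrite (r : ℕ) : Cmd → Bool
  | .set r' _ => r != r'
  | .put _ _ _ => true
  | .seq c d => c.noWrite r && d.noWrite r
  | .ite _ c d => c.noWrite r && d.noWrite r
  | .loop i _ c => r != i && c.noWrite r
  | .skip => true

/-- `c` does not write array `a`. -/
def Cmd.noStore (a : Fin 8) : Cmd → Bool
  | .set _ _ => true
  | .put a' _ _ => a != a'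
  | .seq c d => c.noStore a && d.noStore a
  | .ite _ c d => c.noStore a && d.noStore a
  | .loop _ _ c => c.noStore a
  | .skip => true

/-- Loops of `c` are bounded by registers in `p`, which `c` does not write, and loop bodies do not
write the loop index. -/
def Cmd.wf (p : ℕ → Bool) : Cmd → Bool
  | .set r _ => !p r
  | .put _ _ _ => true
  | .seq c d => c.wf p && d.wf p
  | .ite _ c d => c.wf p && d.wf p
  | .loop i b c => p b && !p i && c.noWrite i && c.wf p
  | .skip => true

/-- A bound for the number of steps of `c.compile` if all loop bounds are at most `X`. -/
def Cmd.time (X : ℕ) : Cmd → ℕ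
  | .set _ e => e.compile.cost + 1
  | .put a i e => (arrayAddr a i.compile).cost + e.compile.cost + 1
  | .seq c d => c.time X + d.time X
  | .ite b c d => b.compile.cost + 1 + (c.time X + d.time X)
  | .loop _ _ c => 2 + (X * (c.time X + 8) + 4)
  | .skip => 1

/-- The nesting depth of loops. -/
def Cmd.depth : Cmd → ℕ
  | .seq c d => max c.depth d.depth
  | .ite _ c d => max c.depth d.depth
  | .loop _ _ c => c.depth + 1
  | _ => 0

/-- The time of `c` when every loop is run once, up to a constant for each loop. -/
def Cmd.weight : Cmd → ℕ
  | .set _ e => e.compile.cost + 1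
  | .put a i e => (arrayAddr a i.compile).cost + e.compile.cost + 1
  | .seq c d => c.weight + d.weight
  | .ite b c d => b.compile.cost + 1 + (c.weight + d.weight)
  | .loop _ _ c => c.weight + 14
  | .skip => 1

/-- Each loop costs one factor `X + 1`. The `14` in its weight is `6` for initialisation and the
last test plus `8` for the test and increment in each round. -/
theorem Cmd.time_le (X : ℕ) (c : Cmd) : c.time X ≤ c.weight * (X + 1) ^ c.depth := by
  have mono : ∀ {w d d' : ℕ}, d ≤ d' → w * (X + 1) ^ d ≤ w * (X + 1) ^ d' := fun h =>
    Nat.mul_le_mul_left _ (Nat.pow_le_pow_right (Nat.succ_pos X) h)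
  induction c with
  | set | put | skip => simp [Cmd.time, Cmd.weight, Cmd.depth]
  | seq c d ihc ihd =>
    simp only [Cmd.time, Cmd.weight, Cmd.depth, add_mul]
    exact add_le_add (ihc.trans (mono (le_max_left _ _))) (ihd.trans (mono (le_max_right _ _)))
  | ite b c d ihc ihd =>
    simp only [Cmd.time, Cmd.weight, Cmd.depth]
    rw [add_mul (b.compile.cost + 1), add_mul c.weight]
    refine add_le_add (Nat.le_mul_of_pos_right _ (Nat.pow_pos (Nat.succ_pos X))) ?_
    exact add_le_add (ihc.trans (mono (le_max_left _ _))) (ihd.trans (mono (le_max_right _ _)))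
  | loop i b c ih =>
    simp only [Cmd.time, Cmd.weight, Cmd.depth, pow_succ]
    have : 1 ≤ (X + 1) ^ c.depth := Nat.pow_pos (Nat.succ_pos X)
    set Y := (X + 1) ^ c.depth
    nlinarith [Nat.mul_le_mul_left X ih, Nat.mul_le_mul_left X this]

theorem iterate_reg {f : AState → AState} {i r : ℕ} (hr : r ≠ i)
    (hf : ∀ σ, (f σ).reg r = σ.reg r) (σ : AState) (k : ℕ) :
    (iterate f i σ k).reg r = σ.reg r := by
  induction k with
  | zero => rfl
  | succ k ih => simp [iterate, hf, hr, ih]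

theorem iterate_arr {f : AState → AState} {i : ℕ} {a : Fin 8}
    (hf : ∀ σ, (f σ).arr a = σ.arr a) (σ : AState) (k : ℕ) :
    (iterate f i σ k).arr a = σ.arr a := by
  induction k with
  | zero => rfl
  | succ k ih => simp [iterate, hf, ih]

theorem Cmd.den_reg (inp : ℕ → ℕ) {c : Cmd} {r : ℕ} (h : c.noWrite r = true) (σ : AState) :
    (c.den inp σ).reg r = σ.reg r := by
  induction c generalizing σ with
  | set => simp_all [Cmd.noWrite, Cmd.den]
  | put => simp [Cmd.den]
  | skip => rfl
  | seq c d ihc ihd =>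
    simp only [Cmd.noWrite, Bool.and_eq_true] at h
    simp [Cmd.den, ihc h.1, ihd h.2]
  | ite b c d ihc ihd =>
    simp only [Cmd.noWrite, Bool.and_eq_true] at h
    simp only [Cmd.den]
    split_ifs
    · exact ihc h.1 σ
    · exact ihd h.2 σ
  | loop i b c ih =>
    simp only [Cmd.noWrite, Bool.and_eq_true, bne_iff_ne] at h
    simp [Cmd.den, h.1, iterate_reg h.1 (ih h.2)]

theorem Cmd.den_arr (inp : ℕ → ℕ) {c : Cmd} {a : Fin 8} (h : c.noStore a = true) (σ : AState) :
    (c.den inp σ).arr a = σ.arr a := by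
  induction c generalizing σ with
  | set => simp [Cmd.den]
  | put => simp_all [Cmd.noStore, Cmd.den]
  | skip => rfl
  | seq c d ihc ihd =>
    simp only [Cmd.noStore, Bool.and_eq_true] at h
    simp [Cmd.den, ihc h.1, ihd h.2]
  | ite b c d ihc ihd =>
    simp only [Cmd.noStore, Bool.and_eq_true] at h
    simp only [Cmd.den]
    split_ifs
    · exact ihc h.1 σ
    · exact ihd h.2 σ
  | loop i b c ih =>
    simp only [Cmd.noStore] at h
    simp [Cmd.den, iterate_arr (ih h)]

theorem Cmd.noWrite_of_wf {p : ℕ → Bool} {c : Cmd} (h : c.wf p = true) {r : ℕ}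
    (hr : p r = true) : c.noWrite r = true := by
  induction c with
  | set r' =>
    simp only [Cmd.wf, Bool.not_eq_true'] at h
    simp only [Cmd.noWrite, bne_iff_ne]
    rintro rfl
    simp_all
  | put | skip => rfl
  | seq c d ihc ihd | ite b c d ihc ihd =>
    simp only [Cmd.wf, Bool.and_eq_true] at h
    simp [Cmd.noWrite, ihc h.1, ihd h.2]
  | loop i b c ih =>
    simp only [Cmd.wf, Bool.and_eq_true, Bool.not_eq_true'] at h
    simp only [Cmd.noWrite, Bool.and_eq_true, bne_iff_ne]
    refine ⟨?_, ih h.2⟩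
    rintro rfl
    simp_all

/-- The machine state `s` represents the state `σ` of the array language, for an input `inp` of
size `B`. -/
structure Represents (inp : ℕ → ℕ) (B : ℕ) (σ : AState) (s : State) : Prop where
  base : s.reg 0 = B
  reg : ∀ r, s.reg (r + 1) = σ.reg r
  arr : ∀ (a : Fin 8) i, s.mem (B + 1 + a + 8 * i) = σ.arr a i
  input : ∀ j ≤ B, s.mem j = inp j
  zero : ∀ j, B ≤ j → inp j = 0

theorem eval_arrayAddr {inp : ℕ → ℕ} {B : ℕ} {σ : AState} {s : State}
    (h : Represents inp B σ s) (a : Fin 8) (e : Expr) :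
    (arrayAddr a e).eval s = B + 1 + a + 8 * e.eval s := by
  simp only [arrayAddr, Expr.double, Expr.eval, h.base]
  omega

theorem Represents.eval_compile {inp : ℕ → ℕ} {B : ℕ} {σ : AState} {s : State}
    (h : Represents inp B σ s) (e : AExpr) : e.compile.eval s = e.eval inp σ := by
  induction e with
  | const => rfl
  | var i => exact h.reg i
  | get a e ih =>
    simp only [AExpr.compile, Expr.eval, AExpr.eval]
    rw [eval_arrayAddr h, ih, h.arr]
  | inp e ih =>
    simp only [AExpr.compile, Expr.eval, AExpr.eval, ih, h.base]
    -- The compiled address `e - (e - B)` is `min e B`. Reads beyond the input therefore hit cell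
    -- `B`, which lies below all arrays and always holds `0`.
    by_cases hB : e.eval inp σ ≤ B
    · rw [Nat.sub_eq_zero_of_le hB, Nat.sub_zero, h.input _ hB]
    · rw [Nat.sub_sub_self (by omega), h.input B le_rfl, h.zero B le_rfl, h.zero _ (by omega)]
  | add a b iha ihb => simp [AExpr.compile, Expr.eval, AExpr.eval, iha, ihb]
  | sub a b iha ihb => simp [AExpr.compile, Expr.eval, AExpr.eval, iha, ihb]

theorem Represents.setReg {inp : ℕ → ℕ} {B : ℕ} {σ : AState} {s : State}
    (h : Represents inp B σ s) (r x : ℕ) :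
    Represents inp B (σ.setReg r x) ⟨Function.update s.reg (r + 1) x, s.mem⟩ := by
  refine ⟨by simp [Function.update, h.base], fun r' => ?_, h.arr, h.input, h.zero⟩
  simp [Function.update, h.reg]

theorem Represents.setArr {inp : ℕ → ℕ} {B : ℕ} {σ : AState} {s : State}
    (h : Represents inp B σ s) (a : Fin 8) (i x : ℕ) :
    Represents inp B (σ.setArr a i x) ⟨s.reg, Function.update s.mem (B + 1 + a + 8 * i) x⟩ := by
  refine ⟨h.base, h.reg, fun a' i' => ?_, fun j hj => ?_, h.zero⟩
  · simp only [Function.update_apply, AState.setArr_arr]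
    by_cases ha : a' = a
    · subst ha
      by_cases hi : i' = i
      · simp [hi]
      · rw [if_neg (by omega), if_pos rfl, if_neg hi, h.arr]
    · have : a'.1 ≠ a.1 := fun h => ha (Fin.ext h)
      rw [if_neg (by omega), if_neg ha, h.arr]
  · simp only [Function.update_apply]
    rw [if_neg (by omega), h.input j hj]

/-- The registers selected by `p` are never written, so a bound `X` on their initial values bounds
all loops throughout the run. -/
theorem Cmd.exec_compile (inp : ℕ → ℕ) (B : ℕ) {p : ℕ → Bool} {X : ℕ} (c : Cmd) {σ : AState}
    {s : State} (h : Represents inp B σ s) (hc : c.wf p = true)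
    (hX : ∀ r, p r = true → σ.reg r ≤ X) :
    ∃ s' t, Exec c.compile s s' t ∧ t ≤ c.time X ∧ Represents inp B (c.den inp σ) s' := by
  induction c generalizing σ s with
  | set r e =>
    refine ⟨_, _, Exec.assign _ _ _, le_rfl, ?_⟩
    rw [h.eval_compile]
    exact h.setReg _ _
  | put a i e =>
    refine ⟨_, _, Exec.store _ _ _, le_rfl, ?_⟩
    rw [eval_arrayAddr h, h.eval_compile, h.eval_compile]
    exact h.setArr _ _ _
  | skip => exact ⟨s, 1, Exec.skip s, le_rfl, h⟩
  | seq c d ihc ihd =>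
    simp only [Cmd.wf, Bool.and_eq_true] at hc
    obtain ⟨s1, t1, e1, b1, r1⟩ := ihc h hc.1 hX
    obtain ⟨s2, t2, e2, b2, r2⟩ := ihd r1 hc.2 (fun r hr => by
      rw [Cmd.den_reg inp (Cmd.noWrite_of_wf hc.1 hr)]
      exact hX r hr)
    exact ⟨s2, t1 + t2, Exec.seq e1 e2, add_le_add b1 b2, r2⟩
  | ite b c d ihc ihd =>
    simp only [Cmd.wf, Bool.and_eq_true] at hc
    by_cases hb : b.eval inp σ ≠ 0
    · obtain ⟨s1, t1, e1, b1, r1⟩ := ihc h hc.1 hX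
      refine ⟨s1, _, Exec.ite_true (by rwa [h.eval_compile]) e1, ?_, by simpa [Cmd.den, hb]⟩
      simp only [Cmd.time]
      omega
    · obtain ⟨s1, t1, e1, b1, r1⟩ := ihd h hc.2 hX
      rw [not_not] at hb
      refine ⟨s1, _, Exec.ite_false (by rwa [h.eval_compile]) e1, ?_, by simpa [Cmd.den, hb]⟩
      simp only [Cmd.time]
      omega
  | loop i b c ih =>
    simp only [Cmd.wf, Bool.and_eq_true, Bool.not_eq_true'] at hc
    obtain ⟨⟨⟨hpb, hpi⟩, hci⟩, hc⟩ := hc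
    have hne : ∀ {r}, p r = true → r ≠ i := by rintro r hr rfl; simp_all
    have hreg : ∀ {r}, p r = true → ∀ k, (iterate (c.den inp) i σ k).reg r = σ.reg r :=
      fun hr k => iterate_reg (hne hr) (Cmd.den_reg inp (Cmd.noWrite_of_wf hc hr)) σ k
    -- Here `k` rounds are done and `d` remain. The `8` per round pays for the test and the
    -- increment, and the final `4` for the failing test.
    have key : ∀ d k s, k + d = σ.reg b →
        Represents inp B ((iterate (c.den inp) i σ k).setReg i k) s →
        ∃ s' t, Exec (.while (.sub (.var (b + 1)) (.var (i + 1)))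
          (.seq c.compile (.assign (i + 1) (.add (.var (i + 1)) (.const 1))))) s s' t ∧
          t ≤ d * (c.time X + 8) + 4 ∧ Represents inp B ((Cmd.loop i b c).den inp σ) s' := by
      intro d
      induction d with
      | zero =>
        intro k s hk hs
        refine ⟨s, _, Exec.while_false ?_, by simp [Expr.cost], ?_⟩
        · simp only [Expr.eval, hs.reg, AState.setReg_reg, if_true, if_neg (hne hpb), hreg hpb]
          omega
        · rw [Cmd.den, ← hk]
          exact hs
      | succ d ihd =>
        intro k s hk hs
        obtain ⟨s1, t1, e1, b1, r1⟩ := ih hs hc (fun r hr => by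
          simp only [AState.setReg_reg, if_neg (hne hr), hreg hr]
          exact hX r hr)
        have r2 := r1.setReg i (k + 1)
        obtain ⟨s3, t3, e3, b3, r3⟩ := ihd (k + 1) _ (by omega) r2
        have hev : (Expr.add (.var (i + 1)) (.const 1)).eval s1 = k + 1 := by
          simp only [Expr.eval, r1.reg, Cmd.den_reg inp hci, AState.setReg_reg, if_true]
        rw [← hev] at e3
        refine ⟨s3, _, Exec.while_true ?_ (Exec.seq e1 (Exec.assign _ _ _)) e3, ?_, r3⟩
        · simp only [Expr.eval, hs.reg, AState.setReg_reg, if_true, if_neg (hne hpb), hreg hpb]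
          omega
        · simp only [Expr.cost, add_mul]
          omega
    obtain ⟨s', t, e, ht, hr⟩ := key (σ.reg b) 0 _ (by omega) (h.setReg i 0)
    refine ⟨s', _, Exec.seq (Exec.assign _ _ _) e, ?_, hr⟩
    have := Nat.mul_le_mul_right (c.time X + 8) (hX b hpb)
    simp only [Expr.cost, Cmd.time]
    omega

/-- `τ` agrees with `σ` on everything but `i` that `c` does not write. -/
structure Frame (c : Cmd) (i : ℕ) (σ τ : AState) : Prop where
  reg : ∀ r, r ≠ i → c.noWrite r = true → τ.reg r = σ.reg r
  arr : ∀ a, c.noStore a = true → τ.arr a = σ.arr a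

/-- The invariant rule for loops. -/
theorem Cmd.loop_induction (inp : ℕ → ℕ) {i b : ℕ} {c : Cmd} {σ : AState}
    (I : ℕ → AState → Prop) (h0 : I 0 σ)
    (hs : ∀ k < σ.reg b, ∀ τ, Frame c i σ τ → I k τ → I (k + 1) (c.den inp (τ.setReg i k))) :
    ∃ τ, I (σ.reg b) τ ∧ Frame c i σ τ ∧ (Cmd.loop i b c).den inp σ = τ.setReg i (σ.reg b) := by
  have hfr : ∀ k, Frame c i σ (iterate (c.den inp) i σ k) := fun k =>
    ⟨fun r hr h => iterate_reg hr (Cmd.den_reg inp h) σ k,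
      fun a h => iterate_arr (Cmd.den_arr inp h) σ k⟩
  refine ⟨iterate (c.den inp) i σ (σ.reg b), ?_, hfr _, rfl⟩
  have : ∀ k ≤ σ.reg b, I k (iterate (c.den inp) i σ k) := by
    intro k
    induction k with
    | zero => exact fun _ => h0
    | succ k ih => exact fun hk => hs k (by omega) _ (hfr k) (ih (by omega))
  exact this _ le_rfl


/-! ### The algorithm

Registers: `0` number of vertices, `1` size of a matching, `2` number of codes, `3` current code,
`4` unread part of the code, `5` current vertex, `8` result of the forest test, `14` counter,
`15` best size found plus one, `18` last bit read; the others are auxiliary.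
Arrays: `0` offsets of the rows of the adjacency matrix, `1` vertex cover, `2` current forest,
`3` component labels, `4` output. -/

/-- Nonzero if and only if the vertices `u` and `v` are adjacent. -/
def adjE (u v : AExpr) : AExpr := .inp (.add (.get 0 u) v)

/-- Nonzero if and only if `a` and `b` differ. -/
def neE (a b : AExpr) : AExpr := .add (.sub a b) (.sub b a)

/-- Give label `u` to each vertex `u`. -/
def initLabels : Cmd := .loop 11 0 (.put 3 (.var 11) (.var 11))

/-- Replace the label in register `12` by the one in register `13`. -/
def relabel : Cmd :=
  .loop 11 0 (.ite (neE (.get 3 (.var 11)) (.var 12)) .skip (.put 3 (.var 11) (.var 13)))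

/-- Add the edge between the vertices in registers `9` and `10`. -/
def addEdge : Cmd :=
  .set 12 (.get 3 (.var 9)) ;; .set 13 (.get 3 (.var 10)) ;;
    .ite (neE (.var 12) (.var 13)) relabel (.set 8 (.const 0))

/-- Add the edge between the vertices in registers `9` and `10` if it is one of the current set,
in descending direction. -/
def checkPair : Cmd :=
  .ite (.get 2 (.var 9)) (.ite (.get 2 (.var 10)) (.ite (.sub (.var 9) (.var 10))
    (.ite (adjE (.var 9) (.var 10)) addEdge .skip) .skip) .skip) .skip

/-- Test whether the current set induces a forest. -/
def testForest : Cmd :=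
  initLabels ;; .set 8 (.const 1) ;; .loop 9 0 (.loop 10 0 checkPair)

/-- Add the vertex in register `5` to the current set if this yields a forest. -/
def tryAdd : Cmd :=
  .put 2 (.var 5) (.const 1) ;; testForest ;; .ite (.var 8) .skip (.put 2 (.var 5) (.const 0))

/-- Move the last bit of register `4` to register `18`. -/
def readBit : Cmd :=
  .set 6 (.const 0) ;;
  .loop 7 2 (.ite (.sub (.var 4) (.const 1))
    (.set 4 (.sub (.var 4) (.const 2)) ;; .set 6 (.add (.var 6) (.const 1))) .skip) ;;
  .set 18 (.var 4) ;; .set 4 (.var 6)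

/-- Read a bit, and try to add the current vertex if it is `1`. -/
def readAndTry : Cmd := readBit ;; .ite (.var 18) tryAdd .skip

/-- Count the neighbours of the current vertex in the current set. -/
def countNbrs : Cmd :=
  .set 14 (.const 0) ;; .loop 11 0 (.ite (.get 2 (.var 11))
    (.ite (adjE (.var 5) (.var 11)) (.set 14 (.add (.var 14) (.const 1))) .skip) .skip)

/-- Let the code decide about the current vertex if it is in the vertex cover. -/
def coverStep : Cmd := .ite (.get 1 (.var 5)) readAndTry .skip

/-- Let the code decide about the current vertex if it is outside the vertex cover and has two
neighbours in the current set. -/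
def outerStep : Cmd :=
  .ite (.get 1 (.var 5)) .skip
    (countNbrs ;; .ite (.sub (.const 2) (.var 14)) tryAdd readAndTry)

/-- Make the current set empty. -/
def clear : Cmd := .loop 5 0 (.put 2 (.var 5) (.const 0))

/-- Count the vertices outside the current set. -/
def countOutside : Cmd :=
  .set 14 (.const 0) ;;
    .loop 5 0 (.ite (.get 2 (.var 5)) .skip (.set 14 (.add (.var 14) (.const 1))))

/-- Make the complement of the current set the output. -/
def copyOut : Cmd := .loop 5 0 (.put 4 (.var 5) (.sub (.const 1) (.get 2 (.var 5))))

/-- Make the complement of the current set the output if it is larger than the present output. -/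
def record : Cmd :=
  countOutside ;; .ite (.sub (.add (.var 14) (.const 1)) (.var 15))
    (.set 15 (.add (.var 14) (.const 1)) ;; copyOut) .skip

/-- Process one code. -/
def attempt : Cmd :=
  .set 4 (.var 3) ;; clear ;; .loop 5 0 coverStep ;; .loop 5 0 outerStep ;; .loop 5 0 tryAdd ;;
    record

/-- Process all codes. -/
def search : Cmd := .loop 3 2 attempt

/-- Compute the offsets of the rows of the adjacency matrix. -/
def initRows : Cmd :=
  .loop 5 0 (.put 0 (.var 5) (.var 16) ;; .set 16 (.add (.var 16) (.var 0)))

/-- Add the vertices in registers `9` and `10` to the vertex cover if they are adjacent and none of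
them is in it. -/
def matchStep : Cmd :=
  .ite (adjE (.var 9) (.var 10)) (.ite (.get 1 (.var 9)) .skip (.ite (.get 1 (.var 10)) .skip
    (.put 1 (.var 9) (.const 1) ;; .put 1 (.var 10) (.const 1) ;;
      .set 1 (.add (.var 1) (.const 1))))) .skip

/-- Compute the vertex cover of the endpoints of a maximal matching. -/
def buildCover : Cmd := initRows ;; .loop 9 0 (.loop 10 0 matchStep)

/-- Double register `2` a number of times. -/
def doublings : ℕ → Cmd
  | 0 => .skip
  | D + 1 => .set 2 (.add (.var 2) (.var 2)) ;; doublings D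

/-- Compute the number of codes. -/
def countCodes (D : ℕ) : Cmd := .set 2 (.const 1) ;; .loop 5 1 (doublings D)

/-! ### Correctness -/

/-- `f` is the indicator function of `F`. -/
def Marks {n : ℕ} (f : ℕ → ℕ) (F : Finset (Fin n)) : Prop :=
  ∀ v : Fin n, f v = if v ∈ F then 1 else 0

theorem Marks.ne_zero_iff {n : ℕ} {f : ℕ → ℕ} {F : Finset (Fin n)} (h : Marks f F) (v : Fin n) :
    f v ≠ 0 ↔ v ∈ F := by
  rw [h v]; simp

theorem Marks.insert {n : ℕ} {f : ℕ → ℕ} {F : Finset (Fin n)} (h : Marks f F) (v : Fin n) :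
    Marks (fun i => if i = v then 1 else f i) (insert v F) := by
  intro u
  by_cases huv : u = v
  · simp [huv]
  · simp [huv, Fin.val_inj, h u]

theorem Marks.erase {n : ℕ} {f : ℕ → ℕ} {F : Finset (Fin n)} (h : Marks f F) (v : Fin n) :
    Marks (fun i => if i = v then 0 else f i) (F.erase v) := by
  intro u
  by_cases huv : u = v
  · simp [huv]
  · simp [huv, Fin.val_inj, h u]

/-- `inp` is the adjacency matrix of `G`. -/
def IsInput {n : ℕ} (G : SimpleGraph (Fin n)) (inp : ℕ → ℕ) : Prop :=
  ∀ u v : Fin n, inp (u * n + v) ≠ 0 ↔ G.Adj u v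

/-- Register `0` holds the number of vertices and array `0` the offsets of the rows. -/
structure HasRows (n : ℕ) (σ : AState) : Prop where
  size : σ.reg 0 = n
  rows : ∀ u : Fin n, σ.arr 0 u = u * n

/-! ### The forest test, bit reading and neighbour counting -/

section Specs

variable {n : ℕ} {G : SimpleGraph (Fin n)} {inp : ℕ → ℕ}

theorem HasRows.congr {σ τ : AState} (h : HasRows n σ) (h0 : τ.reg 0 = σ.reg 0)
    (ha : τ.arr 0 = σ.arr 0) : HasRows n τ :=
  ⟨h0.trans h.size, fun u => by rw [ha]; exact h.rows u⟩

theorem eval_neE (σ : AState) (a b : AExpr) :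
    (neE a b).eval inp σ ≠ 0 ↔ a.eval inp σ ≠ b.eval inp σ := by
  simp only [neE, AExpr.eval]
  omega

theorem HasRows.eval_adjE {σ : AState} (h : HasRows n σ) (hG : IsInput G inp) {a b : AExpr}
    {u v : Fin n} (ha : a.eval inp σ = u) (hb : b.eval inp σ = v) :
    (adjE a b).eval inp σ ≠ 0 ↔ G.Adj u v := by
  simp only [adjE, AExpr.eval, ha, hb, h.rows u]
  exact hG u v

theorem den_initLabels {σ : AState} (h : HasRows n σ) (u : Fin n) :
    (initLabels.den inp σ).arr 3 u = u := by
  obtain ⟨τ, h1, -, h2⟩ := Cmd.loop_induction inp (i := 11) (b := 0)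
    (c := .put 3 (.var 11) (.var 11)) (σ := σ) (fun k τ => ∀ i < k, τ.arr 3 i = i) (by simp)
    (by
      intro k _ τ _ hI i hi
      simp only [Cmd.den, AExpr.eval, AState.setArr_arr, AState.setReg_reg, AState.setReg_arr,
        if_true]
      split_ifs with h
      · exact h.symm
      · exact hI i (by omega))
  rw [initLabels, h2]
  exact h1 u (by rw [h.size]; exact u.2)

theorem den_relabel {σ : AState} (h : HasRows n σ) (u : Fin n) :
    (relabel.den inp σ).arr 3 u = if σ.arr 3 u = σ.reg 12 then σ.reg 13 else σ.arr 3 u := by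
  obtain ⟨τ, h1, -, h2⟩ := Cmd.loop_induction inp (i := 11) (b := 0)
    (c := .ite (neE (.get 3 (.var 11)) (.var 12)) .skip (.put 3 (.var 11) (.var 13))) (σ := σ)
    (fun k τ => ∀ i, τ.arr 3 i =
      if i < k ∧ σ.arr 3 i = σ.reg 12 then σ.reg 13 else σ.arr 3 i) (by simp)
    (by
      intro k _ τ hf hI i
      have h12 := hf.reg 12 (by decide) rfl
      have h13 := hf.reg 13 (by decide) rfl
      simp only [Cmd.den, eval_neE]
      simp only [AExpr.eval, AState.setReg_reg, AState.setReg_arr]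
      have hk := hI k
      have hi := hI i
      split_ifs <;> simp_all <;> grind)
  rw [relabel, h2, AState.setReg_arr, h1 u]
  simp [h.size]

/-- The state of the forest test after the edges of `H` have been added. -/
def TestInv (R H : SimpleGraph (Fin n)) (σ : AState) : Prop :=
  (σ.reg 8 ≠ 0 ∧ H.IsAcyclic ∧ LabelsComponents (σ.arr 3) H) ∨ (σ.reg 8 = 0 ∧ ¬ R.IsAcyclic)

/-- A new edge closes a cycle exactly when its endpoints already carry the same label; otherwise two
labels are merged. Once the flag is `0` it is never reset, since the graph tested is known to have a
cycle. -/
theorem den_checkPair {σ : AState} (h : HasRows n σ) (hG : IsInput G inp)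
    {F : Finset (Fin n)} (hF : Marks (σ.arr 2) F) {a b : Fin n} (ha : σ.reg 9 = a)
    (hb : σ.reg 10 = b) (hI : TestInv (restrict G F) (edgesBefore (restrict G F) a b) σ) :
    TestInv (restrict G F) (edgesBefore (restrict G F) a (b + 1)) (checkPair.den inp σ) := by
  have hadj := h.eval_adjE hG (a := .var 9) (b := .var 10) ha hb
  by_cases hab : b < a ∧ (restrict G F).Adj a b
  · obtain ⟨hlt, hR⟩ := hab
    have hne : a ≠ b := hR.ne
    have e : checkPair.den inp σ = addEdge.den inp σ := by
      have h1 := (hF.ne_zero_iff a).2 hR.2.1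
      have h2 := (hF.ne_zero_iff b).2 hR.2.2
      have h3 := hadj.2 hR.1
      have h4 : (a : ℕ) - b ≠ 0 := by omega
      rw [checkPair, Cmd.den, if_pos (by simpa [AExpr.eval, ha] using h1), Cmd.den,
        if_pos (by simpa [AExpr.eval, hb] using h2), Cmd.den,
        if_pos (by simpa [AExpr.eval, ha, hb] using h4), Cmd.den, if_pos h3]
    rw [e, edgesBefore_succ hlt hR]
    rcases hI with ⟨h8, hac, hl⟩ | ⟨h8, hac⟩
    · by_cases hcomp : σ.arr 3 a = σ.arr 3 b
      · right
        constructor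
        · simp [addEdge, Cmd.den, eval_neE, AExpr.eval, ha, hb, hcomp]
        · intro hRac
          have hle : edgesBefore (restrict G F) a b ⊔ SimpleGraph.edge a b ≤ restrict G F := by
            rw [← edgesBefore_succ hlt hR]
            exact edgesBefore_le _ _ _
          -- Acyclicity with an edge between already connected endpoints would force the edge to be
          -- old or a loop.
          have := (SimpleGraph.isAcyclic_sup_fromEdgeSet_iff.1 (hRac.anti hle)).2
            ((hl a b).1 hcomp)
          exact this.elim hne not_edgesBefore_adj
      · left
        have e2 : addEdge.den inp σ =
            relabel.den inp ((σ.setReg 12 (σ.arr 3 a)).setReg 13 (σ.arr 3 b)) := by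
          simp [addEdge, Cmd.den, eval_neE, AExpr.eval, ha, hb, hcomp]
        rw [e2]
        refine ⟨?_, ?_, ?_⟩
        · rw [Cmd.den_reg inp (by rfl)]
          simpa using h8
        · exact hac.sup_edge_of_not_reachable (fun hr => hcomp ((hl a b).2 hr))
        · refine hl.sup_edge hne fun u => ?_
          rw [den_relabel (h.congr (by simp) (by simp))]
          simp
    · right
      refine ⟨?_, hac⟩
      have : ∀ τ : AState, (addEdge.den inp τ).reg 8 = τ.reg 8 ∨
          (addEdge.den inp τ).reg 8 = 0 := by
        intro τ
        by_cases hc : τ.arr 3 (τ.reg 9) = τ.arr 3 (τ.reg 10)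
        · right
          simp [addEdge, Cmd.den, eval_neE, AExpr.eval, hc]
        · left
          have e2 : addEdge.den inp τ = relabel.den inp
              ((τ.setReg 12 (τ.arr 3 (τ.reg 9))).setReg 13 (τ.arr 3 (τ.reg 10))) := by
            simp [addEdge, Cmd.den, eval_neE, AExpr.eval, hc]
          rw [e2, Cmd.den_reg inp (by rfl)]
          simp
      rcases this σ with h' | h'
      · rw [h', h8]
      · exact h'
  · have e : checkPair.den inp σ = σ := by
      simp only [checkPair, Cmd.den]
      split_ifs with h1 h2 h3 h4
      · exfalso
        simp only [AExpr.eval, ha, hb] at h1 h2 h3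
        exact hab ⟨by omega, hadj.1 h4, (hF.ne_zero_iff a).1 h1, (hF.ne_zero_iff b).1 h2⟩
      all_goals rfl
    rw [e, edgesBefore_succ_of_not hab]
    exact hI

theorem TestInv.congr {R H : SimpleGraph (Fin n)} {σ τ : AState} (h : TestInv R H σ)
    (h8 : τ.reg 8 = σ.reg 8) (h3 : τ.arr 3 = σ.arr 3) : TestInv R H τ := by
  unfold TestInv
  rw [h8, h3]
  exact h

/-- Each edge is inserted once, from its larger to its smaller endpoint, in lexicographic order;
after the last row all of `restrict G F` has been inserted. -/
theorem den_testForest {σ : AState} (h : HasRows n σ) (hG : IsInput G inp)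
    {F : Finset (Fin n)} (hF : Marks (σ.arr 2) F) :
    (testForest.den inp σ).reg 8 ≠ 0 ↔ InducesForest G F := by
  set R := restrict G F with hR
  set σ₁ := (initLabels.den inp σ).setReg 8 1 with hσ₁
  have hrows : HasRows n σ₁ := h.congr
    (by simp [hσ₁, Cmd.den_reg inp (c := initLabels) (r := 0) rfl])
    (by simp [hσ₁, Cmd.den_arr inp (c := initLabels) (a := 0) rfl])
  have hF₁ : Marks (σ₁.arr 2) F := by
    simpa [hσ₁, Cmd.den_arr inp (c := initLabels) (a := 2) rfl] using hF
  have h0 : TestInv R (edgesBefore R 0 0) σ₁ := by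
    left
    rw [edgesBefore_zero]
    refine ⟨by simp [hσ₁], SimpleGraph.isAcyclic_bot, fun u v => ?_⟩
    rw [hσ₁, AState.setReg_arr, den_initLabels h, den_initLabels h]
    exact labelsComponents_bot u v
  obtain ⟨τ, h1, -, h2⟩ := Cmd.loop_induction inp (i := 9) (b := 0)
    (c := .loop 10 0 checkPair) (σ := σ₁) (fun k τ => TestInv R (edgesBefore R k 0) τ) h0
    (by
      intro a ha τ hf hI
      rw [hrows.size] at ha
      set τ' := τ.setReg 9 a with hτ'
      have h' : HasRows n τ' := hrows.congr (by simp [hτ', hf.reg 0 (by decide) rfl])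
        (by simp [hτ', hf.arr 0 rfl])
      have hF' : Marks (τ'.arr 2) F := by simpa [hτ', hf.arr 2 rfl] using hF₁
      obtain ⟨ρ, h1, -, h2⟩ := Cmd.loop_induction inp (i := 10) (b := 0) (c := checkPair)
        (σ := τ') (fun k ρ => TestInv R (edgesBefore R a k) ρ)
        (hI.congr (by simp [hτ']) (by simp [hτ']))
        (by
          intro b hb ρ hf' hI'
          rw [h'.size] at hb
          exact den_checkPair (a := ⟨a, ha⟩) (b := ⟨b, hb⟩)
            (h'.congr (by simp [hf'.reg 0 (by decide) rfl]) (by simp [hf'.arr 0 rfl])) hG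
            (by simpa [hf'.arr 2 rfl] using hF') (by simp [hf'.reg 9 (by decide) rfl, hτ'])
            (by simp) (hI'.congr (by simp) (by simp)))
      rw [h2]
      rw [h'.size, edgesBefore_row] at h1
      exact h1.congr (by simp) (by simp))
  rw [hrows.size, edgesBefore_last] at h1
  have e : (testForest.den inp σ).reg 8 = τ.reg 8 := by
    have : testForest.den inp σ = (Cmd.loop 9 0 (.loop 10 0 checkPair)).den inp σ₁ := rfl
    rw [this, h2]
    simp
  rw [e]
  rcases h1 with ⟨h8, hac, -⟩ | ⟨h8, hac⟩
  · exact ⟨fun _ => hac, fun _ => h8⟩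
  · exact ⟨fun h' => absurd h8 h', fun h' => absurd h' hac⟩

open Classical in
theorem den_tryAdd {σ : AState} (h : HasRows n σ) (hG : IsInput G inp)
    {F : Finset (Fin n)} (hF : Marks (σ.arr 2) F) (hforest : InducesForest G F) {v : Fin n}
    (hv : σ.reg 5 = v) :
    Marks ((tryAdd.den inp σ).arr 2)
      (if InducesForest G (insert v F) then insert v F else F) := by
  set σ₁ := σ.setArr 2 v 1 with hσ₁
  have hF₁ : Marks (σ₁.arr 2) (insert v F) := by simpa [hσ₁] using hF.insert v
  have ht := den_testForest (inp := inp) (h.congr (τ := σ₁) (by simp [hσ₁]) (by simp [hσ₁])) hG hF₁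
  have harr : (testForest.den inp σ₁).arr 2 = σ₁.arr 2 := Cmd.den_arr inp rfl _
  have hreg : (testForest.den inp σ₁).reg 5 = v := by
    rw [Cmd.den_reg inp rfl]
    simpa [hσ₁] using hv
  have e : tryAdd.den inp σ = if (testForest.den inp σ₁).reg 8 ≠ 0 then testForest.den inp σ₁
      else (testForest.den inp σ₁).setArr 2 v 0 := by
    simp only [tryAdd, Cmd.den, AExpr.eval, hv, ← hσ₁, hreg]
  rw [e]
  by_cases hf : InducesForest G (insert v F)
  · rw [if_pos (ht.2 hf), if_pos hf, harr]
    exact hF₁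
  · rw [if_neg (fun h' => hf (ht.1 h')), if_neg hf]
    have hvF : v ∉ F := fun hvF => hf (by rwa [Finset.insert_eq_of_mem hvF])
    have := hF₁.erase v
    rw [Finset.erase_insert hvF] at this
    simpa [harr] using this

/-- The machine has no division, so halving is repeated subtraction of `2`. Register `2` serves as
loop bound, and `P` rounds suffice because the number is at most `P`. -/
theorem den_readBit {σ : AState} {P : ℕ} (hP : σ.reg 2 = P) (hx : σ.reg 4 ≤ P) :
    (readBit.den inp σ).reg 4 = σ.reg 4 / 2 ∧ (readBit.den inp σ).reg 18 = σ.reg 4 % 2 := by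
  obtain ⟨τ, ⟨h1, h1'⟩, -, h2⟩ := Cmd.loop_induction inp (i := 7) (b := 2)
    (c := .ite (.sub (.var 4) (.const 1))
      (.set 4 (.sub (.var 4) (.const 2)) ;; .set 6 (.add (.var 6) (.const 1))) .skip)
    (σ := σ.setReg 6 0)
    (fun k τ => 2 * τ.reg 6 + τ.reg 4 = σ.reg 4 ∧ (τ.reg 4 < 2 ∨ τ.reg 6 = k))
    (by simp)
    (by
      intro k _ τ _ hI
      by_cases h : τ.reg 4 - 1 = 0 <;> simp [Cmd.den, AExpr.eval, h] <;> omega)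
  have e : readBit.den inp σ =
      ((τ.setReg 7 ((σ.setReg 6 0).reg 2)).setReg 18 (τ.reg 4)).setReg 4 (τ.reg 6) := by
    simp only [readBit, Cmd.den] at h2 ⊢
    simp only [AExpr.eval] at h2 ⊢
    rw [h2]
    simp
  rw [e]
  simp only [AState.setReg_reg, if_true] at h1' ⊢
  simp at h1' ⊢
  omega

theorem card_filter_lt_succ (Q : Finset (Fin n)) {k : ℕ} (hk : k < n) :
    (Q.filter (fun u => u.1 < k + 1)).card =
      (Q.filter (fun u => u.1 < k)).card + if (⟨k, hk⟩ : Fin n) ∈ Q then 1 else 0 := by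
  have : Q.filter (fun u => u.1 < k + 1) =
      Q.filter (fun u => u.1 < k) ∪ Q.filter (fun u => u = ⟨k, hk⟩) := by
    ext u
    simp only [Finset.mem_filter, Finset.mem_union, Fin.ext_iff, ← and_or_left]
    exact and_congr_right fun _ => by omega
  rw [this, Finset.card_union_of_disjoint]
  · rw [Finset.filter_eq']
    split_ifs <;> simp
  · rw [Finset.disjoint_left]
    intro u
    simp only [Finset.mem_filter, Fin.ext_iff]
    omega

theorem den_countNbrs [DecidableRel G.Adj] {σ : AState} (h : HasRows n σ) (hG : IsInput G inp)
    {F : Finset (Fin n)} (hF : Marks (σ.arr 2) F) {v : Fin n} (hv : σ.reg 5 = v) :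
    (countNbrs.den inp σ).reg 14 = (F.filter (G.Adj v)).card := by
  obtain ⟨τ, h1, -, h2⟩ := Cmd.loop_induction inp (i := 11) (b := 0)
    (c := .ite (.get 2 (.var 11))
      (.ite (adjE (.var 5) (.var 11)) (.set 14 (.add (.var 14) (.const 1))) .skip) .skip)
    (σ := σ.setReg 14 0)
    (fun k τ => τ.reg 14 = ((F.filter (G.Adj v)).filter (fun u => u.1 < k)).card)
    (by simp)
    (by
      intro k hk τ hf hI
      have hk : k < n := by simpa [h.size] using hk
      have h5 : τ.reg 5 = v := by simpa [hv] using hf.reg 5 (by decide) rfl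
      have hrows : HasRows n (τ.setReg 11 k) := h.congr
        (by simpa using hf.reg 0 (by decide) rfl) (by simpa using hf.arr 0 rfl)
      have hadj := hrows.eval_adjE hG (a := .var 5) (b := .var 11) (u := v) (v := ⟨k, hk⟩)
        (by simpa [AExpr.eval] using h5) (by simp [AExpr.eval])
      have h2 : τ.arr 2 k ≠ 0 ↔ (⟨k, hk⟩ : Fin n) ∈ F := by
        rw [hf.arr 2 rfl]
        exact hF.ne_zero_iff ⟨k, hk⟩
      rw [card_filter_lt_succ _ hk, ← hI]
      have e2 : (AExpr.get 2 (.var 11)).eval inp (τ.setReg 11 k) = τ.arr 2 k := by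
        simp [AExpr.eval]
      simp only [Cmd.den, hadj, e2, h2, Finset.mem_filter]
      split_ifs <;> simp_all [AExpr.eval])
  have e : (countNbrs.den inp σ).reg 14 = τ.reg 14 := by
    have : countNbrs.den inp σ = (Cmd.loop 11 0 (.ite (.get 2 (.var 11))
      (.ite (adjE (.var 5) (.var 11)) (.set 14 (.add (.var 14) (.const 1))) .skip) .skip)).den inp
        (σ.setReg 14 0) := rfl
    rw [this, h2]
    simp
  rw [e, h1]
  simp [h.size]

end Specs


/-! ### Codes for subsets, least significant bit first -/

/-- A code `x` for the set `D ∩ Q`, read along the list `l`, with `y` left over at the end. -/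
def encode {n : ℕ} (Q D : Finset (Fin n)) (l : List (Fin n)) (y : ℕ) : ℕ :=
  l.foldr (fun v x => if v ∈ Q then 2 * x + (if v ∈ D then 1 else 0) else x) y

/-- Only members of `Q` use up a bit. The `+ 1` on both sides makes the induction close, as `2 * x +
1 + 1 = 2 * (x + 1)`. -/
theorem encode_lt {n : ℕ} (Q D : Finset (Fin n)) (l : List (Fin n)) (y : ℕ) :
    encode Q D l y + 1 ≤ 2 ^ l.countP (fun v => decide (v ∈ Q)) * (y + 1) := by
  induction l with
  | nil => simp [encode]
  | cons v l ih =>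
    have e : encode Q D (v :: l) y = if v ∈ Q then
      2 * encode Q D l y + (if v ∈ D then 1 else 0) else encode Q D l y := rfl
    rw [e, List.countP_cons]
    by_cases h : v ∈ Q
    · simp only [h, if_true, decide_true, pow_succ]
      split_ifs <;> nlinarith
    · simpa [h] using ih

theorem countP_finRange {n : ℕ} (Q : Finset (Fin n)) :
    (List.finRange n).countP (fun v => decide (v ∈ Q)) = Q.card := by
  rw [List.countP_eq_length_filter,
    ← List.toFinset_card_of_nodup ((List.nodup_finRange n).filter _)]
  congr 1
  ext v
  simp

theorem encode_finRange_lt {n : ℕ} (Q D : Finset (Fin n)) (y : ℕ) :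
    encode Q D (List.finRange n) y < 2 ^ Q.card * (y + 1) := by
  have := encode_lt Q D (List.finRange n) y
  rw [countP_finRange] at this
  omega

theorem encode_drop {n : ℕ} (Q D : Finset (Fin n)) (y : ℕ) {k : ℕ} (hk : k < n) :
    encode Q D ((List.finRange n).drop k) y =
      if (⟨k, hk⟩ : Fin n) ∈ Q then
        2 * encode Q D ((List.finRange n).drop (k + 1)) y +
          (if (⟨k, hk⟩ : Fin n) ∈ D then 1 else 0)
      else encode Q D ((List.finRange n).drop (k + 1)) y := by
  rw [List.drop_eq_getElem_cons (by simpa using hk)]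
  simp [encode]

/-- The data computed before the search: rows, vertex cover `C` and number `P` of codes. -/
structure Ready {n : ℕ} (C : Finset (Fin n)) (P : ℕ) (σ : AState) : Prop where
  hasRows : HasRows n σ
  cover : Marks (σ.arr 1) C
  codes : σ.reg 2 = P

/-! ### Decoding one code, and the search through all codes -/

section Phases

variable {n : ℕ} {G : SimpleGraph (Fin n)} {inp : ℕ → ℕ} {C : Finset (Fin n)} {P : ℕ}

theorem Ready.congr {σ τ : AState} (h : Ready C P σ) (h0 : τ.reg 0 = σ.reg 0)
    (h2 : τ.reg 2 = σ.reg 2) (ha : τ.arr 0 = σ.arr 0) (hc : τ.arr 1 = σ.arr 1) :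
    Ready C P τ :=
  ⟨h.hasRows.congr h0 ha, by rw [hc]; exact h.cover, h2.trans h.codes⟩

theorem Ready.den {σ : AState} (h : Ready C P σ) {c : Cmd} (h0 : c.noWrite 0 = true)
    (h2 : c.noWrite 2 = true) (ha : c.noStore 0 = true) (hc : c.noStore 1 = true) :
    Ready C P (c.den inp σ) :=
  h.congr (Cmd.den_reg inp h0 σ) (Cmd.den_reg inp h2 σ) (Cmd.den_arr inp ha σ)
    (Cmd.den_arr inp hc σ)

theorem Ready.frame {σ τ : AState} (h : Ready C P σ) {c : Cmd} {i : ℕ} (hf : Frame c i σ τ)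
    (hi0 : 0 ≠ i) (hi2 : 2 ≠ i) (h0 : c.noWrite 0 = true)
    (h2 : c.noWrite 2 = true) (ha : c.noStore 0 = true) (hc : c.noStore 1 = true) (x : ℕ) :
    Ready C P (τ.setReg i x) :=
  h.congr (by simp [hi0, hf.reg 0 hi0 h0]) (by simp [hi2, hf.reg 2 hi2 h2])
    (by simp [hf.arr 0 ha]) (by simp [hf.arr 1 hc])

open Classical in
theorem den_readAndTry {σ : AState} (h : Ready C P σ) (hG : IsInput G inp)
    {F : Finset (Fin n)} (hF : Marks (σ.arr 2) F) (hforest : InducesForest G F) {v : Fin n}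
    (hv : σ.reg 5 = v) (hx : σ.reg 4 ≤ P) :
    (readAndTry.den inp σ).reg 4 = σ.reg 4 / 2 ∧
    Marks ((readAndTry.den inp σ).arr 2)
      (if σ.reg 4 % 2 = 1 ∧ InducesForest G (insert v F) then insert v F else F) := by
  obtain ⟨h4, h18⟩ := den_readBit (inp := inp) h.codes hx
  have harr : (readBit.den inp σ).arr 2 = σ.arr 2 := Cmd.den_arr inp rfl σ
  by_cases hb : σ.reg 4 % 2 = 1
  · have e : readAndTry.den inp σ = tryAdd.den inp (readBit.den inp σ) := by
      simp [readAndTry, Cmd.den, AExpr.eval, h18, hb]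
    rw [e, Cmd.den_reg inp rfl]
    refine ⟨h4, ?_⟩
    simp only [hb, true_and]
    refine den_tryAdd (h.den (c := readBit) rfl rfl rfl rfl).hasRows hG (by rwa [harr])
      hforest ?_
    rw [Cmd.den_reg inp rfl]
    exact hv
  · have e : readAndTry.den inp σ = readBit.den inp σ := by
      have : σ.reg 4 % 2 = 0 := by omega
      simp [readAndTry, Cmd.den, AExpr.eval, h18, this]
    rw [e, harr]
    simp only [hb, false_and, if_false]
    exact ⟨h4, hF⟩

theorem den_clear {σ : AState} (h : σ.reg 0 = n) :
    Marks ((clear.den inp σ).arr 2) (∅ : Finset (Fin n)) := by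
  obtain ⟨τ, h1, -, h2⟩ := Cmd.loop_induction inp (i := 5) (b := 0)
    (c := .put 2 (.var 5) (.const 0)) (σ := σ) (fun k τ => ∀ i < k, τ.arr 2 i = 0) (by simp)
    (by
      intro k _ τ _ hI i hi
      simp only [Cmd.den, AExpr.eval, AState.setArr_arr, AState.setReg_reg, AState.setReg_arr,
        if_true]
      split_ifs with h
      · rfl
      · exact hI i (by omega))
  intro u
  rw [clear, h2, AState.setReg_arr, h1 u (by rw [h]; exact u.2)]
  simp

/-- Any code produces a forest inside `C`. On a code of a forest `F` no requested vertex is refused,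
as every intermediate set is a subset of `F`; the unread part `y` is passed on. The bound by `P` is
kept because the next phase also halves the code. -/
theorem den_coverPhase {σ : AState} (h : Ready C P σ) (hG : IsInput G inp)
    (hF : Marks (σ.arr 2) (∅ : Finset (Fin n))) (hx : σ.reg 4 ≤ P) :
    ∃ A ⊆ C, Marks (((Cmd.loop 5 0 coverStep).den inp σ).arr 2) A ∧ InducesForest G A ∧
      ((Cmd.loop 5 0 coverStep).den inp σ).reg 4 ≤ P ∧
      ∀ F y, InducesForest G F → σ.reg 4 = encode C F (List.finRange n) y →
        A = F ∩ C ∧ ((Cmd.loop 5 0 coverStep).den inp σ).reg 4 = y := by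
  obtain ⟨τ, h1, -, h2⟩ := Cmd.loop_induction inp (i := 5) (b := 0) (c := coverStep) (σ := σ)
    (fun k τ => ∃ A ⊆ C, Marks (τ.arr 2) A ∧ InducesForest G A ∧ τ.reg 4 ≤ P ∧
      ∀ F y, InducesForest G F → σ.reg 4 = encode C F (List.finRange n) y →
        A = (F ∩ C).filter (fun u => u.1 < k) ∧
          τ.reg 4 = encode C F ((List.finRange n).drop k) y)
    ⟨∅, Finset.empty_subset _, hF, inducesForest_empty G, hx, fun F y _ h => by simpa using h⟩
    (by
      rintro k hk τ hf ⟨A, hAC, hA, hAf, hτ, hcode⟩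
      have hk : k < n := by rwa [h.hasRows.size] at hk
      set v : Fin n := ⟨k, hk⟩ with hv
      have hfilter : ∀ F : Finset (Fin n), (F ∩ C).filter (fun u => u.1 < k + 1) =
          if v ∈ F ∩ C then insert v ((F ∩ C).filter (fun u => u.1 < k))
          else (F ∩ C).filter (fun u => u.1 < k) := by
        intro F
        ext u
        have : u.1 = k ↔ u = v := by simp [hv, Fin.ext_iff]
        split_ifs with hvF <;> simp only [Finset.mem_insert, Finset.mem_filter] <;>
          constructor <;> intro hu <;> grind
      have hR := h.frame hf (by decide) (by decide) rfl rfl rfl rfl k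
      have hcv : (AExpr.get 1 (.var 5)).eval inp (τ.setReg 5 k) ≠ 0 ↔ v ∈ C := by
        have := hR.cover.ne_zero_iff v
        simpa [AExpr.eval] using this
      by_cases hvC : v ∈ C
      · have e : coverStep.den inp (τ.setReg 5 k) = readAndTry.den inp (τ.setReg 5 k) := by
          rw [coverStep, Cmd.den, if_pos (hcv.2 hvC)]
        obtain ⟨h4, hM⟩ := den_readAndTry (v := v) hR hG (by simpa using hA) hAf (by simp [hv])
          (by simpa using hτ)
        rw [← e] at h4 hM
        refine ⟨_, ?_, hM, ?_, ?_, ?_⟩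
        · split_ifs
          · exact Finset.insert_subset hvC hAC
          · exact hAC
        · split_ifs with hc
          · exact hc.2
          · exact hAf
        · rw [h4]
          simp only [AState.setReg_reg]
          simp
          omega
        · intro F y hFf hy
          obtain ⟨h5, h6⟩ := hcode F y hFf hy
          rw [encode_drop C F y hk, if_pos hvC] at h6
          rw [h4, hfilter]
          have h4' : (τ.setReg 5 k).reg 4 = τ.reg 4 := by simp
          rw [h4']
          by_cases hvF : v ∈ F
          · rw [if_pos hvF] at h6
            have hin : InducesForest G (insert v A) := by
              refine hFf.anti (Finset.insert_subset hvF ?_)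
              rw [h5]
              exact (Finset.filter_subset _ _).trans Finset.inter_subset_left
            rw [if_pos (Finset.mem_inter.2 ⟨hvF, hvC⟩), if_pos ⟨by omega, hin⟩, h5]
            exact ⟨rfl, by omega⟩
          · rw [if_neg hvF] at h6
            rw [if_neg (fun h => hvF (Finset.mem_inter.1 h).1), if_neg (by omega)]
            exact ⟨h5, by omega⟩
      · have e : coverStep.den inp (τ.setReg 5 k) = τ.setReg 5 k := by
          rw [coverStep, Cmd.den, if_neg (fun h => hvC (hcv.1 h)), Cmd.den]
        rw [e]
        refine ⟨A, hAC, by simpa using hA, hAf, by simpa using hτ, ?_⟩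
        intro F y hFf hy
        obtain ⟨h5, h6⟩ := hcode F y hFf hy
        rw [encode_drop C F y hk, if_neg hvC] at h6
        rw [hfilter, if_neg (fun h => hvC (Finset.mem_inter.1 h).2)]
        exact ⟨h5, by simpa using h6⟩)
  rw [h2]
  simp only [AState.setReg_arr, AState.setReg_reg]
  rw [h.hasRows.size] at h1
  obtain ⟨A, hAC, hA, hAf, hτ, hcode⟩ := h1
  refine ⟨A, hAC, hA, hAf, by simpa using hτ, fun F y hFf hy => ?_⟩
  obtain ⟨h5, h6⟩ := hcode F y hFf hy
  exact ⟨by simpa using h5, by rwa [List.drop_of_length_le (by simp)] at h6⟩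

/-- The current set keeps its trace `A` on `C`, so the neighbours counted are those in `A` and the
test recognises the branch vertices. The others are added without reading a bit, as they belong to
every maximal forest with trace `A`. -/
theorem den_outerPhase [DecidableRel G.Adj] {σ : AState} (h : Ready C P σ) (hG : IsInput G inp)
    (hC : ∀ u v, G.Adj u v → u ∈ C ∨ v ∈ C) {A : Finset (Fin n)} (hAC : A ⊆ C)
    (hA : Marks (σ.arr 2) A) (hAf : InducesForest G A) (hx : σ.reg 4 ≤ P) :
    ∃ F, A ⊆ F ∧ Marks (((Cmd.loop 5 0 outerStep).den inp σ).arr 2) F ∧ InducesForest G F ∧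
      ∀ F', IsMaxForest G F' → A = F' ∩ C →
        σ.reg 4 = encode (branchVertices G C A) F' (List.finRange n) 0 → F = F' := by
  obtain ⟨τ, h1, -, h2⟩ := Cmd.loop_induction inp (i := 5) (b := 0) (c := outerStep) (σ := σ)
    (fun k τ => ∃ F, F ∩ C = A ∧ Marks (τ.arr 2) F ∧ InducesForest G F ∧ τ.reg 4 ≤ P ∧
      ∀ F', IsMaxForest G F' → A = F' ∩ C →
        σ.reg 4 = encode (branchVertices G C A) F' (List.finRange n) 0 →
        F = F'.filter (fun u => u ∈ C ∨ u.1 < k) ∧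
          τ.reg 4 = encode (branchVertices G C A) F' ((List.finRange n).drop k) 0)
    ⟨A, Finset.inter_eq_left.2 hAC, hA, hAf, hx, fun F' _ hA' h =>
      ⟨by simpa [Finset.filter_mem_eq_inter] using hA', by simpa using h⟩⟩
    (by
      rintro k hk τ hf ⟨F, hFC, hF, hFf, hτ, hcode⟩
      have hk : k < n := by rwa [h.hasRows.size] at hk
      set v : Fin n := ⟨k, hk⟩ with hv
      have hfilter : ∀ F' : Finset (Fin n), v ∉ C → F'.filter (fun u => u ∈ C ∨ u.1 < k + 1) =
          if v ∈ F' then insert v (F'.filter (fun u => u ∈ C ∨ u.1 < k))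
          else F'.filter (fun u => u ∈ C ∨ u.1 < k) := by
        intro F' hvC
        ext u
        have : u.1 = k ↔ u = v := by simp [hv, Fin.ext_iff]
        split_ifs with hvF <;> simp only [Finset.mem_insert, Finset.mem_filter] <;>
          constructor <;> intro hu <;> grind
      have hR := h.frame hf (by decide) (by decide) rfl rfl rfl rfl k
      have h5v : (τ.setReg 5 k).reg 5 = v := by simp [hv]
      have h4' : (τ.setReg 5 k).reg 4 = τ.reg 4 := by simp
      have hcv : (AExpr.get 1 (.var 5)).eval inp (τ.setReg 5 k) ≠ 0 ↔ v ∈ C := by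
        have := hR.cover.ne_zero_iff v
        simpa [AExpr.eval] using this
      by_cases hvC : v ∈ C
      · have e : outerStep.den inp (τ.setReg 5 k) = τ.setReg 5 k := by
          rw [outerStep, Cmd.den, if_pos (hcv.2 hvC), Cmd.den]
        rw [e]
        refine ⟨F, hFC, by simpa using hF, hFf, by simpa using hτ, ?_⟩
        intro F' hF' hAF' hy
        obtain ⟨h5, h6⟩ := hcode F' hF' hAF' hy
        rw [encode_drop _ F' 0 hk, if_neg (by simp [branchVertices, ← hv, hvC])] at h6
        refine ⟨?_, by simpa using h6⟩
        rw [h5]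
        ext u
        have : u.1 = k → u ∈ C := fun hu => (Fin.ext hu : u = v) ▸ hvC
        simp only [Finset.mem_filter]
        refine and_congr_right fun _ => ⟨by grind, ?_⟩
        rintro (hu | hu)
        · exact Or.inl hu
        · by_cases huk : u.1 = k
          · exact Or.inl (this huk)
          · exact Or.inr (by omega)
      have hinC : (insert v F) ∩ C = A := by
        rw [Finset.insert_inter_of_notMem hvC, hFC]
      set ρ := countNbrs.den inp (τ.setReg 5 k) with hρ
      have hRρ : Ready C P ρ := hR.den rfl rfl rfl rfl
      have h14 : ρ.reg 14 = (A.filter (G.Adj v)).card := by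
        rw [hρ, den_countNbrs hR.hasRows hG (by simpa using hF) h5v, ← hFC,
          filter_adj_inter_eq hC hvC]
      have hFρ : Marks (ρ.arr 2) F := by
        rw [hρ, Cmd.den_arr inp rfl]
        simpa using hF
      have h5ρ : ρ.reg 5 = v := by
        rw [hρ, Cmd.den_reg inp rfl]
        exact h5v
      have h4ρ : ρ.reg 4 = τ.reg 4 := by
        rw [hρ, Cmd.den_reg inp rfl]
        exact h4'
      have e : outerStep.den inp (τ.setReg 5 k) =
          if (A.filter (G.Adj v)).card < 2 then tryAdd.den inp ρ else readAndTry.den inp ρ := by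
        rw [outerStep, Cmd.den, if_neg (fun h => hvC (hcv.1 h)), Cmd.den, ← hρ, Cmd.den]
        simp only [AExpr.eval, h14, ne_eq, Nat.sub_eq_zero_iff_le, not_le]
      by_cases hcard : (A.filter (G.Adj v)).card < 2
      · have hin : InducesForest G (insert v F) := by
          refine inducesForest_insert_of_card_le_one hFf ?_
          rw [← filter_adj_inter_eq hC hvC, hFC]
          omega
        have hM := den_tryAdd hRρ.hasRows hG hFρ hFf h5ρ
        rw [if_pos hin] at hM
        rw [e, if_pos hcard]
        refine ⟨insert v F, hinC, hM, hin, ?_, ?_⟩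
        · rw [Cmd.den_reg inp rfl, h4ρ]
          exact hτ
        · intro F' hF' hAF' hy
          obtain ⟨h5, h6⟩ := hcode F' hF' hAF' hy
          -- With fewer than two neighbours in the trace of `F'` on `C`, the vertex could join `F'`;
          -- maximality puts it there.
          have hvF' : v ∈ F' := by
            by_contra hvF'
            refine hF'.2 v hvF' (inducesForest_insert_of_card_le_one hF'.1 ?_)
            rw [← filter_adj_inter_eq hC hvC, ← hAF']
            omega
          rw [encode_drop _ F' 0 hk, if_neg (by simp [branchVertices, ← hv]; omega)] at h6
          rw [hfilter F' hvC, if_pos hvF', ← h5, Cmd.den_reg inp rfl, h4ρ]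
          exact ⟨rfl, h6⟩
      · obtain ⟨h4, hM⟩ := den_readAndTry hRρ hG hFρ hFf h5ρ (by rwa [h4ρ])
        rw [e, if_neg hcard]
        rw [h4ρ] at h4 hM
        refine ⟨_, ?_, hM, ?_, ?_, ?_⟩
        · split_ifs
          · exact hinC
          · exact hFC
        · split_ifs with hc
          · exact hc.2
          · exact hFf
        · omega
        · intro F' hF' hAF' hy
          obtain ⟨h5, h6⟩ := hcode F' hF' hAF' hy
          rw [encode_drop _ F' 0 hk,
            if_pos (by simp only [branchVertices, ← hv, Finset.mem_filter]; simp [hvC]; omega)] at h6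
          rw [h4, hfilter F' hvC]
          by_cases hvF' : v ∈ F'
          · rw [if_pos hvF'] at h6
            have hin : InducesForest G (insert v F) := by
              refine hF'.1.anti (Finset.insert_subset hvF' ?_)
              rw [h5]
              exact Finset.filter_subset _ _
            rw [if_pos hvF', if_pos ⟨by omega, hin⟩, ← h5]
            exact ⟨rfl, by omega⟩
          · rw [if_neg hvF'] at h6
            rw [if_neg hvF', if_neg (by omega)]
            exact ⟨h5, by omega⟩)
  rw [h2]
  simp only [AState.setReg_arr]
  rw [h.hasRows.size] at h1
  obtain ⟨F, hFC, hF, hFf, hτ, hcode⟩ := h1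
  refine ⟨F, hFC ▸ Finset.inter_subset_left, hF, hFf, fun F' hF' hAF' hy => ?_⟩
  obtain ⟨h5, -⟩ := hcode F' hF' hAF' hy
  rw [h5]
  exact Finset.filter_true_of_mem fun u _ => Or.inr u.2

-- One pass is enough: a vertex refused once would close a cycle with every later, larger set as
-- well.
open Classical in
theorem den_extendPhase {σ : AState} (h : Ready C P σ) (hG : IsInput G inp)
    {F : Finset (Fin n)} (hF : Marks (σ.arr 2) F) (hFf : InducesForest G F) :
    ∃ F', F ⊆ F' ∧ Marks (((Cmd.loop 5 0 tryAdd).den inp σ).arr 2) F' ∧ IsMaxForest G F' := by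
  obtain ⟨τ, h1, -, h2⟩ := Cmd.loop_induction inp (i := 5) (b := 0) (c := tryAdd) (σ := σ)
    (fun k τ => ∃ F', F ⊆ F' ∧ Marks (τ.arr 2) F' ∧ InducesForest G F' ∧
      ∀ v : Fin n, v.1 < k → v ∉ F' → ¬ InducesForest G (insert v F'))
    ⟨F, subset_rfl, hF, hFf, by simp⟩
    (by
      rintro k hk τ hf ⟨F', hFF', hF', hFf', hmax⟩
      have hk : k < n := by rwa [h.hasRows.size] at hk
      have hR := h.frame hf (by decide) (by decide) rfl rfl rfl rfl k
      have hM := den_tryAdd (v := ⟨k, hk⟩) hR.hasRows hG (by simpa using hF') hFf' (by simp)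
      refine ⟨_, ?_, hM, ?_, ?_⟩
      · split_ifs
        · exact hFF'.trans (Finset.subset_insert _ _)
        · exact hFF'
      · split_ifs with hin
        · exact hin
        · exact hFf'
      · intro v hv hvF
        by_cases hvk : v = ⟨k, hk⟩
        · subst hvk
          split_ifs at hvF ⊢ with hin
          · exact absurd (Finset.mem_insert_self _ _) hvF
          · exact hin
        · have hvk' : v.1 < k := by
            have : v.1 ≠ k := fun h => hvk (Fin.ext h)
            omega
          have hsub : F' ⊆ _ := (by split_ifs <;> simp :
            F' ⊆ if InducesForest G (insert (⟨k, hk⟩ : Fin n) F') then insert ⟨k, hk⟩ F' else F')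
          exact fun hin => hmax v hvk' (fun hv' => hvF (hsub hv'))
            (hin.anti (Finset.insert_subset_insert v hsub)))
  rw [h2]
  obtain ⟨F', hFF', hF', hFf', hmax⟩ := h1
  rw [h.hasRows.size] at hmax
  exact ⟨F', hFF', by simpa using hF', hFf', fun v hv => hmax v v.2 hv⟩

theorem IsMaxForest.eq_of_subset {F F' : Finset (Fin n)} (hF : IsMaxForest G F) (h : F ⊆ F')
    (hF' : InducesForest G F') : F' = F := by
  refine Finset.Subset.antisymm (fun v hv => ?_) h
  by_contra hvF
  exact hF.2 v hvF (hF'.anti (Finset.insert_subset hv h))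

theorem den_countOutside {σ : AState} (h : σ.reg 0 = n) {F : Finset (Fin n)}
    (hF : Marks (σ.arr 2) F) : (countOutside.den inp σ).reg 14 = Fᶜ.card := by
  obtain ⟨τ, h1, -, h2⟩ := Cmd.loop_induction inp (i := 5) (b := 0)
    (c := .ite (.get 2 (.var 5)) .skip (.set 14 (.add (.var 14) (.const 1))))
    (σ := σ.setReg 14 0) (fun k τ => τ.reg 14 = (Fᶜ.filter (fun u => u.1 < k)).card) (by simp)
    (by
      intro k hk τ hf hI
      have hk : k < n := by simpa [h] using hk
      have h2 := hF.ne_zero_iff ⟨k, hk⟩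
      have h3 : τ.arr 2 = σ.arr 2 := by simpa using hf.arr 2 rfl
      rw [card_filter_lt_succ _ hk, ← hI]
      by_cases hkF : (⟨k, hk⟩ : Fin n) ∈ F
      · have := h2.2 hkF
        simp_all [Cmd.den, AExpr.eval]
      · have : σ.arr 2 k = 0 := by
          by_contra h'
          exact hkF (h2.1 h')
        simp_all [Cmd.den, AExpr.eval])
  have e : countOutside.den inp σ = (Cmd.loop 5 0
    (.ite (.get 2 (.var 5)) .skip (.set 14 (.add (.var 14) (.const 1))))).den inp
      (σ.setReg 14 0) := rfl
  rw [e, h2]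
  simp [h1, h]

theorem den_copyOut {σ : AState} (h : σ.reg 0 = n) {F : Finset (Fin n)}
    (hF : Marks (σ.arr 2) F) : Marks ((copyOut.den inp σ).arr 4) Fᶜ := by
  obtain ⟨τ, h1, -, h2⟩ := Cmd.loop_induction inp (i := 5) (b := 0)
    (c := .put 4 (.var 5) (.sub (.const 1) (.get 2 (.var 5))))
    (σ := σ) (fun k τ => ∀ i < k, τ.arr 4 i = 1 - σ.arr 2 i) (by simp)
    (by
      intro k _ τ hf hI i hi
      simp only [Cmd.den, AExpr.eval, AState.setArr_arr, AState.setReg_reg, AState.setReg_arr,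
        if_true]
      split_ifs with h
      · rw [hf.arr 2 rfl, h]
      · exact hI i (by omega))
  intro u
  rw [copyOut, h2, AState.setReg_arr, h1 u (by rw [h]; exact u.2), hF u]
  by_cases hu : u ∈ F <;> simp [hu]

/-- The output is the complement of a maximal forest, or there is no output yet. -/
def Recorded (G : SimpleGraph (Fin n)) (σ : AState) : Prop :=
  σ.reg 15 = 0 ∨ ∃ F, IsMaxForest G F ∧ Marks (σ.arr 4) Fᶜ ∧ σ.reg 15 = Fᶜ.card + 1

/-- Register `15` holds the size plus one, so that `0` means that nothing is recorded and even an
empty output counts as an improvement. -/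
theorem den_record {σ : AState} (h : σ.reg 0 = n) {F : Finset (Fin n)}
    (hF : Marks (σ.arr 2) F) (hmax : IsMaxForest G F) (hrec : Recorded G σ) :
    Recorded G (record.den inp σ) ∧ σ.reg 15 ≤ (record.den inp σ).reg 15 ∧
      Fᶜ.card + 1 ≤ (record.den inp σ).reg 15 := by
  set τ := countOutside.den inp σ with hτ
  have h14 : τ.reg 14 = Fᶜ.card := den_countOutside h hF
  have h15 : τ.reg 15 = σ.reg 15 := Cmd.den_reg inp rfl σ
  by_cases hlt : σ.reg 15 < Fᶜ.card + 1
  · have e : record.den inp σ = copyOut.den inp (τ.setReg 15 (Fᶜ.card + 1)) := by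
      have : Fᶜ.card + 1 - σ.reg 15 ≠ 0 := by omega
      simp only [record, Cmd.den, ← hτ, AExpr.eval, h14, h15]
      rw [if_pos this]
    have h15' : (record.den inp σ).reg 15 = Fᶜ.card + 1 := by
      rw [e, Cmd.den_reg inp rfl]
      simp
    refine ⟨Or.inr ⟨F, hmax, ?_, h15'⟩, by omega, h15'.ge⟩
    rw [e]
    refine den_copyOut ?_ ?_
    · simpa [hτ, Cmd.den_reg inp (c := countOutside) (r := 0) rfl] using h
    · simpa [hτ, Cmd.den_arr inp (c := countOutside) (a := 2) rfl] using hF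
  · have e : record.den inp σ = τ := by
      have : ¬ (Fᶜ.card + 1 - σ.reg 15 ≠ 0) := by omega
      simp only [record, Cmd.den, ← hτ, AExpr.eval, h14, h15]
      rw [if_neg this]
    rw [e]
    refine ⟨?_, h15.ge, by omega⟩
    unfold Recorded
    rw [h15, hτ, Cmd.den_arr inp (c := countOutside) (a := 4) rfl]
    exact hrec

theorem Recorded.congr {σ τ : AState} (h : Recorded G σ) (h15 : τ.reg 15 = σ.reg 15)
    (h4 : τ.arr 4 = σ.arr 4) : Recorded G τ := by
  unfold Recorded
  rw [h15, h4]
  exact h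

/-- The two guarantees serve the two cases of the analysis. A code that begins with the trace of
`F'` gives a maximal forest containing this trace, and the full code of `F'` gives `F'` itself,
which the extension phase cannot enlarge. -/
theorem den_attempt [DecidableRel G.Adj] {σ : AState} (h : Ready C P σ) (hG : IsInput G inp)
    (hC : ∀ u v, G.Adj u v → u ∈ C ∨ v ∈ C) (hz : σ.reg 3 ≤ P) (hrec : Recorded G σ) :
    Recorded G (attempt.den inp σ) ∧ σ.reg 15 ≤ (attempt.den inp σ).reg 15 ∧
    ∃ F, IsMaxForest G F ∧ Fᶜ.card + 1 ≤ (attempt.den inp σ).reg 15 ∧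
      ∀ F', IsMaxForest G F' →
        (∀ y, σ.reg 3 = encode C F' (List.finRange n) y → F' ∩ C ⊆ F) ∧
        (σ.reg 3 = encode C F' (List.finRange n)
          (encode (branchVertices G C (F' ∩ C)) F' (List.finRange n) 0) → F = F') := by
  set σ₁ := clear.den inp (σ.setReg 4 (σ.reg 3)) with hσ₁
  have h₁ : Ready C P σ₁ := (h.congr (τ := σ.setReg 4 (σ.reg 3)) rfl rfl rfl rfl).den
    (c := clear) rfl rfl rfl rfl
  have h4 : σ₁.reg 4 = σ.reg 3 := by
    rw [hσ₁, Cmd.den_reg inp rfl]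
    simp
  obtain ⟨A, hAC, hA, hAf, hx, hcode⟩ := den_coverPhase h₁ hG (den_clear (by simp [h.hasRows.size]))
    (by rwa [h4])
  set σ₂ := (Cmd.loop 5 0 coverStep).den inp σ₁ with hσ₂
  have h₂ : Ready C P σ₂ := h₁.den rfl rfl rfl rfl
  obtain ⟨F₁, hAF₁, hF₁, hF₁f, hcode'⟩ := den_outerPhase h₂ hG hC hAC hA hAf hx
  set σ₃ := (Cmd.loop 5 0 outerStep).den inp σ₂ with hσ₃
  have h₃ : Ready C P σ₃ := h₂.den rfl rfl rfl rfl
  obtain ⟨F, hF₁F, hF, hmax⟩ := den_extendPhase h₃ hG hF₁ hF₁f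
  set σ₄ := (Cmd.loop 5 0 tryAdd).den inp σ₃ with hσ₄
  have h₄ : Ready C P σ₄ := h₃.den rfl rfl rfl rfl
  have h15 : σ₄.reg 15 = σ.reg 15 := by
    rw [hσ₄, Cmd.den_reg inp rfl, hσ₃, Cmd.den_reg inp rfl, hσ₂, Cmd.den_reg inp rfl, hσ₁,
      Cmd.den_reg inp rfl]
    rfl
  have h4arr : σ₄.arr 4 = σ.arr 4 := by
    rw [hσ₄, Cmd.den_arr inp rfl, hσ₃, Cmd.den_arr inp rfl, hσ₂, Cmd.den_arr inp rfl, hσ₁,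
      Cmd.den_arr inp rfl]
    rfl
  obtain ⟨hr1, hr2, hr3⟩ := den_record (inp := inp) h₄.hasRows.size hF hmax (hrec.congr h15 h4arr)
  have e : attempt.den inp σ = record.den inp σ₄ := rfl
  rw [e]
  refine ⟨hr1, h15 ▸ hr2, F, hmax, hr3, fun F' hF' => ⟨fun y hy => ?_, fun hy => ?_⟩⟩
  · rw [← (hcode F' y hF'.1 (by rw [h4, hy])).1]
    exact hAF₁.trans hF₁F
  · obtain ⟨hA', hy'⟩ := hcode F' _ hF'.1 (by rw [h4, hy])
    have := hcode' F' hF' hA' (by rw [hy', hA'])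
    subst this
    exact hF'.eq_of_subset hF₁F hmax.1

theorem den_search [DecidableRel G.Adj] {σ : AState} (h : Ready C P σ) (hG : IsInput G inp)
    (hC : ∀ u v, G.Adj u v → u ∈ C ∨ v ∈ C) (hP : 0 < P) (h15 : σ.reg 15 = 0) :
    ∃ F, IsMaxForest G F ∧ Marks ((search.den inp σ).arr 4) Fᶜ ∧
      ∀ z < P, ∃ F₁, IsMaxForest G F₁ ∧ F₁ᶜ.card ≤ Fᶜ.card ∧ ∀ F', IsMaxForest G F' →
        (∀ y, z = encode C F' (List.finRange n) y → F' ∩ C ⊆ F₁) ∧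
        (z = encode C F' (List.finRange n)
          (encode (branchVertices G C (F' ∩ C)) F' (List.finRange n) 0) → F₁ = F') := by
  obtain ⟨τ, ⟨hrec, hall⟩, -, h2⟩ := Cmd.loop_induction inp (i := 3) (b := 2) (c := attempt)
    (σ := σ) (fun k τ => Recorded G τ ∧
      ∀ z < k, ∃ F₁, IsMaxForest G F₁ ∧ F₁ᶜ.card + 1 ≤ τ.reg 15 ∧ ∀ F', IsMaxForest G F' →
        (∀ y, z = encode C F' (List.finRange n) y → F' ∩ C ⊆ F₁) ∧
        (z = encode C F' (List.finRange n)
          (encode (branchVertices G C (F' ∩ C)) F' (List.finRange n) 0) → F₁ = F'))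
    ⟨Or.inl h15, by simp⟩
    (by
      rintro k hk τ hf ⟨hrec, hall⟩
      rw [h.codes] at hk
      have hR := h.frame hf (by decide) (by decide) rfl rfl rfl rfl k
      have h3 : (τ.setReg 3 k).reg 3 = k := by simp
      have h15' : (τ.setReg 3 k).reg 15 = τ.reg 15 := by simp
      obtain ⟨hr, hle, F, hF, hc, hq⟩ := den_attempt hR hG hC (by omega) (hrec.congr h15' rfl)
      rw [h3] at hq
      refine ⟨hr, fun z hz => ?_⟩
      by_cases hzk : z = k
      · subst hzk
        exact ⟨F, hF, hc, hq⟩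
      · obtain ⟨F₁, hF₁, hc₁, hq₁⟩ := hall z (by omega)
        exact ⟨F₁, hF₁, by omega, hq₁⟩)
  rw [h.codes] at hall
  have e4 : (search.den inp σ).arr 4 = τ.arr 4 := by
    rw [search, h2]
    rfl
  rw [e4]
  rcases hrec with h0 | ⟨F, hF, hM, hc⟩
  -- Code `0` has been processed, so register `15` is positive.
  · obtain ⟨F₁, -, hc₁, -⟩ := hall 0 hP
    omega
  · refine ⟨F, hF, hM, fun z hz => ?_⟩
    obtain ⟨F₁, hF₁, hc₁, hq⟩ := hall z hz
    exact ⟨F₁, hF₁, by omega, hq⟩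

/-- If there are enough codes, the search loses at most a `1 / k` fraction. -/
theorem mul_opt_le_of_search [DecidableRel G.Adj] (hC : ∀ u v, G.Adj u v → u ∈ C ∨ v ∈ C)
    {F : Finset (Fin n)} {k : ℕ} (hP : 2 ^ (C.card * (k + 2)) ≤ P)
    (hF : ∀ z < P, ∃ F₁, IsMaxForest G F₁ ∧ F₁ᶜ.card ≤ Fᶜ.card ∧ ∀ F', IsMaxForest G F' →
        (∀ y, z = encode C F' (List.finRange n) y → F' ∩ C ⊆ F₁) ∧
        (z = encode C F' (List.finRange n)
          (encode (branchVertices G C (F' ∩ C)) F' (List.finRange n) 0) → F₁ = F')) :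
    k * opt G ≤ k * Fᶜ.card + opt G := by
  obtain ⟨F', hF', hopt⟩ := exists_isMaxForest_card_eq_opt G
  set J := branchVertices G C (F' ∩ C) with hJ
  by_cases hcard : J.card ≤ C.card * (k + 1)
  -- Few branch vertices: the full code uses `|C| + |J| ≤ |C| * (k + 2)` bits, so the optimum itself
  -- is among the candidates.
  · have hz : encode C F' (List.finRange n) (encode J F' (List.finRange n) 0) < P := by
      have h1 := encode_finRange_lt J F' 0
      have h2 := encode_finRange_lt C F' (encode J F' (List.finRange n) 0)
      refine h2.trans_le (le_trans ?_ hP)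
      rw [show C.card * (k + 2) = C.card + C.card * (k + 1) by ring, pow_add]
      refine Nat.mul_le_mul_left _ (le_trans ?_ (Nat.pow_le_pow_right (by norm_num) hcard))
      omega
    obtain ⟨F₁, -, hc, hq⟩ := hF _ hz
    have := (hq F' hF').2 rfl
    rw [this, hopt] at hc
    exact (Nat.mul_le_mul_left k hc).trans (Nat.le_add_right _ _)
  -- Many branch vertices: only the trace on `C` is guessed, with `0` as the remaining code.
  · have hz : encode C F' (List.finRange n) 0 < P := by
      refine (encode_finRange_lt C F' 0).trans_le (le_trans ?_ hP)
      rw [zero_add, mul_one]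
      exact Nat.pow_le_pow_right (by norm_num) (Nat.le_mul_of_pos_right _ (by omega))
    obtain ⟨F₁, hF₁, hc, hq⟩ := hF _ hz
    have hsub := (hq F' hF').1 0 rfl
    have h1 := hF₁.1.card_branchVertices_le (C := C) hsub Finset.inter_subset_right
    have h2 := hF'.card_compl_le hC
    have h3 := hF₁.card_le_opt
    have h4 : (C \ (F' ∩ C)).card + (F' ∩ C).card = C.card :=
      Finset.card_sdiff_add_card_eq_card Finset.inter_subset_right
    rw [hopt] at h2
    rw [← hJ] at h1 h2
    -- With `A = F' ∩ C`, the optimum is at most `|C \ A| + |J|`, and `|J| ≤ |F₁ᶜ| + |A|`.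
    have h5 : opt G ≤ Fᶜ.card + C.card := by omega
    -- Here `|C| * (k + 1) < |J| ≤ |F₁ᶜ| + |A| ≤ opt G + |C|`.
    have h6 : k * C.card ≤ opt G := by
      have : C.card * (k + 1) = k * C.card + C.card := by ring
      omega
    calc k * opt G ≤ k * (Fᶜ.card + C.card) := Nat.mul_le_mul_left k h5
      _ = k * Fᶜ.card + k * C.card := by ring
      _ ≤ _ := by omega

end Phases


/-! ### Row offsets, the greedy matching cover and the number of codes -/

section Preparation

variable {n : ℕ} {G : SimpleGraph (Fin n)} {inp : ℕ → ℕ}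

theorem den_initRows {σ : AState} (h : σ.reg 0 = n) (h16 : σ.reg 16 = 0) :
    HasRows n (initRows.den inp σ) := by
  obtain ⟨τ, ⟨h1, -⟩, hf, h2⟩ := Cmd.loop_induction inp (i := 5) (b := 0)
    (c := .put 0 (.var 5) (.var 16) ;; .set 16 (.add (.var 16) (.var 0))) (σ := σ)
    (fun k τ => (∀ i < k, τ.arr 0 i = i * n) ∧ τ.reg 16 = k * n) (by simp [h16])
    (by
      rintro k _ τ hf ⟨hI, h16⟩
      have h0 : τ.reg 0 = n := (hf.reg 0 (by decide) rfl).trans h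
      refine ⟨fun i hi => ?_, by simp [Cmd.den, AExpr.eval, h16, h0, add_mul]⟩
      by_cases hik : i = k
      · simp [Cmd.den, AExpr.eval, h16, hik]
      · simpa [Cmd.den, AExpr.eval, hik] using hI i (by omega))
  rw [initRows, h2]
  refine ⟨by simp [hf.reg 0 (by decide) rfl, h], fun u => ?_⟩
  rw [AState.setReg_arr]
  exact h1 u (by rw [h]; exact u.2)

/-- `C` consists of the endpoints of a matching whose size is in register `1`, and it covers the
edges before `(a, b)` in the lexicographic order. -/
structure CoverInv (G : SimpleGraph (Fin n)) (a b : ℕ) (C : Finset (Fin n)) (σ : AState) :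
    Prop where
  marks : Marks (σ.arr 1) C
  card : C.card = 2 * σ.reg 1
  le_card : ∀ X : Finset (Fin n), (∀ u v, G.Adj u v → u ∈ X ∨ v ∈ X) → σ.reg 1 ≤ (X ∩ C).card
  covers : ∀ u v : Fin n, G.Adj u v → (u.1 < a ∨ u.1 = a ∧ v.1 < b) → u ∈ C ∨ v ∈ C

theorem CoverInv.congr {a b : ℕ} {C : Finset (Fin n)} {σ τ : AState} (h : CoverInv G a b C σ)
    (h1 : τ.reg 1 = σ.reg 1) (ha : τ.arr 1 = σ.arr 1) : CoverInv G a b C τ := by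
  refine ⟨?_, ?_, ?_, h.covers⟩
  · rw [ha]; exact h.marks
  · rw [h1]; exact h.card
  · rw [h1]; exact h.le_card

theorem den_matchStep {σ : AState} (h : HasRows n σ) (hG : IsInput G inp) {C : Finset (Fin n)}
    {a b : Fin n} (ha : σ.reg 9 = a) (hb : σ.reg 10 = b) (hI : CoverInv G a b C σ) :
    ∃ C', CoverInv G a (b + 1) C' (matchStep.den inp σ) := by
  have hadj := h.eval_adjE hG (a := .var 9) (b := .var 10) ha hb
  have hCa := hI.marks.ne_zero_iff a
  have hCb := hI.marks.ne_zero_iff b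
  by_cases hnew : G.Adj a b ∧ a ∉ C ∧ b ∉ C
  · obtain ⟨hab, haC, hbC⟩ := hnew
    have hne := hab.ne
    have e : matchStep.den inp σ =
        ((σ.setArr 1 a 1).setArr 1 b 1).setReg 1 (σ.reg 1 + 1) := by
      have h1 : σ.arr 1 a = 0 := by
        by_contra h'
        exact haC (hCa.1 h')
      have h2 : σ.arr 1 b = 0 := by
        by_contra h'
        exact hbC (hCb.1 h')
      rw [matchStep, Cmd.den, if_pos (hadj.2 hab)]
      simp [Cmd.den, AExpr.eval, ha, hb, h1, h2]
    have hbC' : b ∉ insert a C := by simp [hbC, hne.symm]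
    rw [e]
    refine ⟨insert b (insert a C), ?_, ?_, ?_, ?_⟩
    · have := (hI.marks.insert a).insert b
      intro u
      rw [← this u]
      simp
    · rw [Finset.card_insert_of_notMem hbC', Finset.card_insert_of_notMem haC, hI.card]
      simp
      ring
    · intro X hX
      have h1 := hI.le_card X hX
      simp only [AState.setReg_reg, if_true]
      -- A vertex cover `X` contains an endpoint of the new matching edge, and this endpoint is new
      -- because matching edges are disjoint.
      have h2 : ∃ w ∈ X, w ∉ C ∧ w ∈ insert b (insert a C) := by
        rcases hX a b hab with h' | h'
        · exact ⟨a, h', haC, by simp⟩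
        · exact ⟨b, h', hbC, by simp⟩
      obtain ⟨w, hwX, hwC, hw⟩ := h2
      have h3 : insert w (X ∩ C) ⊆ X ∩ insert b (insert a C) := by
        intro x hx
        rcases Finset.mem_insert.1 hx with rfl | hx
        · exact Finset.mem_inter.2 ⟨hwX, hw⟩
        · simp only [Finset.mem_inter, Finset.mem_insert] at hx ⊢
          tauto
      have h4 := Finset.card_le_card h3
      rw [Finset.card_insert_of_notMem (by simp [hwC])] at h4
      omega
    · intro u v huv hlt
      by_cases huv' : u = a ∧ v = b
      · simp [huv'.1]
      · have := hI.covers u v huv (by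
          rw [Fin.ext_iff, Fin.ext_iff] at huv'
          omega)
        simp only [Finset.mem_insert]
        tauto
  · have e : matchStep.den inp σ = σ := by
      by_cases h1 : G.Adj a b
      · rw [matchStep, Cmd.den, if_pos (hadj.2 h1)]
        by_cases h2 : a ∈ C
        · have := hCa.2 h2
          simp [Cmd.den, AExpr.eval, ha, this]
        · have h3 : b ∈ C := by tauto
          have h4 := hCb.2 h3
          have h5 : σ.arr 1 a = 0 := by
            by_contra h'
            exact h2 (hCa.1 h')
          simp [Cmd.den, AExpr.eval, ha, hb, h4, h5]
      · rw [matchStep, Cmd.den, if_neg (fun h' => h1 (hadj.1 h')), Cmd.den]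
    rw [e]
    refine ⟨C, hI.marks, hI.card, hI.le_card, fun u v huv hlt => ?_⟩
    by_cases huv' : u = a ∧ v = b
    · obtain ⟨rfl, rfl⟩ := huv'
      tauto
    · refine hI.covers u v huv ?_
      rw [Fin.ext_iff, Fin.ext_iff] at huv'
      omega

theorem den_buildCover {σ : AState} (h : σ.reg 0 = n) (h16 : σ.reg 16 = 0) (h1 : σ.reg 1 = 0)
    (ha : ∀ i, σ.arr 1 i = 0) (hG : IsInput G inp) :
    HasRows n (buildCover.den inp σ) ∧ ∃ C : Finset (Fin n),
      Marks ((buildCover.den inp σ).arr 1) C ∧ C.card = 2 * (buildCover.den inp σ).reg 1 ∧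
      (∀ u v, G.Adj u v → u ∈ C ∨ v ∈ C) ∧ (buildCover.den inp σ).reg 1 ≤ vc G := by
  set σ₁ := initRows.den inp σ with hσ₁
  have hrows : HasRows n σ₁ := den_initRows h h16
  have h0 : CoverInv G 0 0 ∅ σ₁ := by
    refine ⟨fun u => ?_, ?_, ?_, by simp⟩
    · rw [hσ₁, Cmd.den_arr inp rfl, ha]
      simp
    all_goals
      rw [hσ₁, Cmd.den_reg inp rfl, h1]
      simp
  obtain ⟨τ, ⟨C, hC⟩, hf, h2⟩ := Cmd.loop_induction inp (i := 9) (b := 0)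
    (c := .loop 10 0 matchStep) (σ := σ₁) (fun k τ => ∃ C, CoverInv G k 0 C τ) ⟨∅, h0⟩
    (by
      rintro a ha τ hf ⟨C, hC⟩
      rw [hrows.size] at ha
      set τ' := τ.setReg 9 a with hτ'
      have h' : HasRows n τ' := hrows.congr (by simp [hτ', hf.reg 0 (by decide) rfl])
        (by simp [hτ', hf.arr 0 rfl])
      obtain ⟨ρ, ⟨C₁, hC₁⟩, -, h2⟩ := Cmd.loop_induction inp (i := 10) (b := 0) (c := matchStep)
        (σ := τ') (fun k ρ => ∃ C, CoverInv G a k C ρ)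
        ⟨C, hC.congr (by simp [hτ']) (by simp [hτ'])⟩
        (by
          rintro b hb ρ hf' ⟨C', hC'⟩
          rw [h'.size] at hb
          exact den_matchStep (a := ⟨a, ha⟩) (b := ⟨b, hb⟩)
            (h'.congr (by simp [hf'.reg 0 (by decide) rfl]) (by simp [hf'.arr 0 rfl])) hG
            (by simp [hf'.reg 9 (by decide) rfl, hτ']) (by simp)
            (hC'.congr (by simp) (by simp)))
      rw [h2]
      rw [h'.size] at hC₁
      refine ⟨C₁, CoverInv.congr (σ := ρ) ⟨hC₁.marks, hC₁.card, hC₁.le_card, ?_⟩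
        (by simp) (by simp)⟩
      intro u v huv hlt
      have := v.2
      exact hC₁.covers u v huv (by omega))
  have e : buildCover.den inp σ = τ.setReg 9 (σ₁.reg 0) := h2
  rw [hrows.size] at hC
  obtain ⟨X, hX, hXc⟩ := exists_vertexCover_card_eq_vc G
  rw [e]
  refine ⟨hrows.congr (by simp [hf.reg 0 (by decide) rfl]) (by simp [hf.arr 0 rfl]), C, ?_, ?_,
    fun u v huv => hC.covers u v huv (Or.inl u.2), ?_⟩
  · simpa using hC.marks
  · simpa using hC.card
  · rw [← hXc]
    simpa using (hC.le_card X hX).trans (Finset.card_le_card Finset.inter_subset_left)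

theorem noWrite_doublings (D : ℕ) {r : ℕ} (hr : r ≠ 2) :
    (doublings D).noWrite r = true := by
  induction D with
  | zero => rfl
  | succ D ih => simp [doublings, Cmd.noWrite, ih, hr]

theorem noStore_doublings (D : ℕ) (a : Fin 8) : (doublings D).noStore a = true := by
  induction D with
  | zero => rfl
  | succ D ih => simp [doublings, Cmd.noStore, ih]

theorem wf_doublings (D : ℕ) {p : ℕ → Bool} (hp : p 2 = false) : (doublings D).wf p = true := by
  induction D with
  | zero => rfl
  | succ D ih => simp [doublings, Cmd.wf, ih, hp]

theorem time_doublings (D X : ℕ) : (doublings D).time X = 4 * D + 1 := by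
  induction D with
  | zero => rfl
  | succ D ih =>
    simp only [doublings, Cmd.time, ih, AExpr.compile, Expr.cost]
    ring

theorem den_doublings (D : ℕ) (σ : AState) :
    ((doublings D).den inp σ).reg 2 = 2 ^ D * σ.reg 2 := by
  induction D generalizing σ with
  | zero => simp [doublings, Cmd.den]
  | succ D ih =>
    simp only [doublings, Cmd.den, ih, AExpr.eval, AState.setReg_reg, if_true, pow_succ]
    ring

theorem noWrite_countCodes (D : ℕ) {r : ℕ} (hr : r ≠ 2) (hr' : r ≠ 5) :
    (countCodes D).noWrite r = true := by
  simp [countCodes, Cmd.noWrite, noWrite_doublings D hr, hr, hr']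

theorem noStore_countCodes (D : ℕ) (a : Fin 8) : (countCodes D).noStore a = true := by
  simp [countCodes, Cmd.noStore, noStore_doublings]

/-- The `D` doublings are unrolled, since `D` depends only on `ε` and is part of the program; the
loop repeats them once per matching edge. -/
theorem den_countCodes (D : ℕ) (σ : AState) :
    ((countCodes D).den inp σ).reg 2 = 2 ^ (σ.reg 1 * D) := by
  obtain ⟨τ, h1, -, h2⟩ := Cmd.loop_induction inp (i := 5) (b := 1) (c := doublings D)
    (σ := σ.setReg 2 1) (fun k τ => τ.reg 2 = 2 ^ (k * D)) (by simp)
    (by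
      intro k _ τ _ hI
      rw [den_doublings]
      simp only [AState.setReg_reg]
      simp only [Nat.reduceEqDiff, if_false, hI]
      ring)
  have e : (countCodes D).den inp σ = (Cmd.loop 5 1 (doublings D)).den inp (σ.setReg 2 1) := rfl
  rw [e, h2]
  simp [h1]

end Preparation

/-! ### The machine program -/

/-- Compute `n * n` in register `0` and move `n` to register `1`. -/
def prologue : Prog :=
  .seq (.assign 1 (.var 0)) (.seq (.assign 2 (.var 0)) (.seq (.assign 0 (.const 0))
    (.while (.var 2) (.seq (.assign 0 (.add (.var 0) (.var 1)))
      (.assign 2 (.sub (.var 2) (.const 1)))))))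

/-- Copy array `4` to the beginning of the memory. -/
def epilogue : Prog :=
  .seq (.assign 2 (.const 0)) (.while (.sub (.var 1) (.var 2))
    (.seq (.store (.var 2) (.load (arrayAddr 4 (.var 2))))
      (.assign 2 (.add (.var 2) (.const 1)))))

/-- The algorithm, with `2 ^ (m * D)` codes if the greedy matching has size `m`. -/
def maxMinFVSProg (D : ℕ) : Prog :=
  .seq prologue (.seq buildCover.compile (.seq (countCodes D).compile
    (.seq search.compile epilogue)))

/-- The state of the array language at the beginning. -/
def AState.start (n : ℕ) : AState := ⟨fun r => if r = 0 then n else 0, fun _ _ => 0⟩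

theorem isInput_inputState {n : ℕ} (G : SimpleGraph (Fin n)) : IsInput G (inputState G).mem := by
  intro u v
  simp only [inputState, ne_eq, ite_eq_right_iff, one_ne_zero, imp_false, not_not]
  constructor
  · rintro ⟨u', v', h, hadj⟩
    have hn : 0 < n := u.pos
    have h1 : u.1 = u'.1 := by
      have := congrArg (· / n) h
      simpa [Nat.mul_comm _ n, Nat.mul_add_div hn, Nat.div_eq_of_lt] using this
    have h2 : v.1 = v'.1 := by rw [h1] at h; omega
    rwa [Fin.ext h1, Fin.ext h2]
  · exact fun h => ⟨u, v, rfl, h⟩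

theorem inputState_mem_eq_zero {n : ℕ} (G : SimpleGraph (Fin n)) {j : ℕ} (hj : n * n ≤ j) :
    (inputState G).mem j = 0 := by
  simp only [inputState, ite_eq_right_iff, one_ne_zero, imp_false]
  rintro ⟨u, v, rfl, -⟩
  have h1 : (u.1 + 1) * n ≤ n * n := Nat.mul_le_mul_right n u.2
  have := v.2
  rw [add_mul] at h1
  omega

/-- The square `n * n`, computed by repeated addition, is the base address behind which the arrays
lie. The counter in register `2` ends at `0`, as the initial state of the array language requires.
-/
theorem exec_prologue {n : ℕ} (G : SimpleGraph (Fin n)) :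
    ∃ s t, Exec prologue (inputState G) s t ∧ t ≤ 10 * n + 8 ∧
      Represents (inputState G).mem (n * n) (AState.start n) s := by
  let f : ℕ → ℕ → ℕ → ℕ := fun a d r => if r = 0 then a else if r = 1 then n else
    if r = 2 then d else 0
  have key : ∀ d a, ∃ t, Exec (.while (.var 2) (.seq (.assign 0 (.add (.var 0) (.var 1)))
      (.assign 2 (.sub (.var 2) (.const 1))))) ⟨f a d, (inputState G).mem⟩
      ⟨f (a + d * n) 0, (inputState G).mem⟩ t ∧ t ≤ 10 * d + 2 := by
    intro d
    induction d with
    | zero =>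
      intro a
      refine ⟨_, ?_, le_refl (0 + 2)⟩
      rw [zero_mul, add_zero]
      exact Exec.while_false (by simp [Expr.eval, f])
    | succ d ih =>
      intro a
      obtain ⟨t, e, ht⟩ := ih (a + n)
      have e1 := Exec.assign 0 (.add (.var 0) (.var 1)) ⟨f a (d + 1), (inputState G).mem⟩
      have e2 := Exec.assign 2 (.sub (.var 2) (.const 1)) ⟨f (a + n) (d + 1), (inputState G).mem⟩
      have h1 : Function.update (f a (d + 1)) 0
          ((Expr.add (.var 0) (.var 1)).eval ⟨f a (d + 1), (inputState G).mem⟩) =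
          f (a + n) (d + 1) := by
        funext r
        simp only [Function.update_apply, Expr.eval, f]
        split_ifs <;> simp_all
      have h2 : Function.update (f (a + n) (d + 1)) 2
          ((Expr.sub (.var 2) (.const 1)).eval ⟨f (a + n) (d + 1), (inputState G).mem⟩) =
          f (a + n) d := by
        funext r
        simp only [Function.update_apply, Expr.eval, f]
        split_ifs <;> simp_all
      simp only [h1] at e1
      simp only [h2] at e2
      rw [show a + (d + 1) * n = a + n + d * n by ring]
      refine ⟨_, Exec.while_true (by simp [Expr.eval, f]) (Exec.seq e1 e2) e, ?_⟩
      simp only [Expr.cost]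
      omega
  obtain ⟨t, e, ht⟩ := key n 0
  have h0 : f 0 n = Function.update (Function.update (Function.update (inputState G).reg 1 n)
      2 n) 0 0 := by
    funext r
    simp only [Function.update_apply, inputState, f]
    split_ifs <;> simp_all
  rw [h0] at e
  refine ⟨_, _, Exec.seq (Exec.assign _ _ _) (Exec.seq (Exec.assign _ _ _)
    (Exec.seq (Exec.assign _ _ _) e)), ?_, ?_⟩
  · simp only [Expr.cost]
    omega
  · refine ⟨by simp [f], fun r => ?_, fun a i => ?_, fun _ _ => rfl,
      fun j hj => inputState_mem_eq_zero G hj⟩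
    · by_cases hr : r = 0 <;> simp [f, AState.start, hr]
    · exact inputState_mem_eq_zero G (by omega)

theorem exec_epilogue {n B : ℕ} {inp : ℕ → ℕ} {σ : AState} {s : State}
    (h : Represents inp B σ s) (hn : σ.reg 0 = n) (hB : n ≤ B) :
    ∃ s' t, Exec epilogue s s' t ∧ t ≤ 30 * n + 6 ∧ ∀ v < n, s'.mem v = σ.arr 4 v := by
  have key : ∀ d k s, k + d = n → s.reg 0 = B → s.reg 1 = n → s.reg 2 = k →
      (∀ i, s.mem (B + 1 + 4 + 8 * i) = σ.arr 4 i) → (∀ v < k, s.mem v = σ.arr 4 v) →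
      ∃ s' t, Exec (.while (.sub (.var 1) (.var 2))
        (.seq (.store (.var 2) (.load (arrayAddr 4 (.var 2))))
          (.assign 2 (.add (.var 2) (.const 1))))) s s' t ∧ t ≤ 30 * d + 4 ∧
        ∀ v < n, s'.mem v = σ.arr 4 v := by
    intro d
    induction d with
    | zero =>
      intro k s hk _ h1 h2 _ hv
      refine ⟨s, _, Exec.while_false ?_, by simp [Expr.cost], by rwa [← show k = n by omega]⟩
      simp only [Expr.eval, h1, h2]
      omega
    | succ d ih =>
      intro k s hk h0 h1 h2 harr hv
      have e1 := Exec.store (.var 2) (.load (arrayAddr 4 (.var 2))) s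
      have hval : (Expr.load (arrayAddr 4 (.var 2))).eval s = σ.arr 4 k := by
        rw [← harr k]
        simp only [Expr.eval, arrayAddr, Expr.double, h0, h2]
        congr 1
        simp
        omega
      have hadr : (Expr.var 2).eval s = k := h2
      rw [hval, hadr] at e1
      have e2 := Exec.assign 2 (.add (.var 2) (.const 1))
        ⟨s.reg, Function.update s.mem k (σ.arr 4 k)⟩
      have hval2 : (Expr.add (.var 2) (.const 1)).eval
          ⟨s.reg, Function.update s.mem k (σ.arr 4 k)⟩ = k + 1 := by
        simp only [Expr.eval, h2]
      rw [hval2] at e2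
      obtain ⟨s', t, e, ht, hs'⟩ := ih (k + 1)
        ⟨Function.update s.reg 2 (k + 1), Function.update s.mem k (σ.arr 4 k)⟩ (by omega)
        (by simp [h0]) (by simp [h1]) (by simp)
        (fun i => by
          simp only [Function.update_apply]
          -- The cell written is `k < n ≤ B`, below all arrays, so copying does not damage the
          -- source.
          rw [if_neg (by omega), harr])
        (fun v hvk => by
          simp only [Function.update_apply]
          split_ifs with hvk'
          · rw [hvk']
          · exact hv v (by omega))
      refine ⟨s', _, Exec.while_true ?_ (Exec.seq e1 e2) e, ?_, hs'⟩
      · simp only [Expr.eval, h1, h2]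
        omega
      · simp only [Expr.cost, arrayAddr, Expr.double]
        omega
  obtain ⟨s', t, e, ht, hs'⟩ := key n 0
    ⟨Function.update s.reg 2 ((Expr.const 0).eval s), s.mem⟩ (by omega) (by simp [h.base])
    (by simp [h.reg 0, hn]) (by simp [Expr.eval]) (fun i => h.arr 4 i) (by simp)
  refine ⟨s', _, Exec.seq (Exec.assign _ _ _) e, ?_, hs'⟩
  simp only [Expr.cost]
  omega

/-- The algorithm computes a minimal feedback vertex set. -/
theorem exec_maxMinFVSProg (D : ℕ) {n : ℕ} (G : SimpleGraph (Fin n)) :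
    ∃ s t m, Exec (maxMinFVSProg D) (inputState G) s t ∧ m ≤ vc G ∧ m ≤ n ∧
      t ≤ (10 * n + 8) + (buildCover.weight * (n + 1) ^ buildCover.depth +
        ((8 + m * (4 * D + 9)) + (search.weight * (max n (2 ^ (m * D)) + 1) ^ search.depth +
          (30 * n + 6)))) ∧
      IsMinimalFVS G (outputSet n s) ∧
      ∀ k, D = 2 * (k + 2) → k * opt G ≤ k * (outputSet n s).card + opt G := by
  classical
  set inp := (inputState G).mem
  have hG : IsInput G inp := isInput_inputState G
  obtain ⟨s₀, t₀, e₀, ht₀, r₀⟩ := exec_prologue G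
  set σ₀ := AState.start n with hσ₀
  -- The program is run in three stages, each with its own `p` and `X`, because the matching size
  -- and the number of codes are computed before they become loop bounds.
  obtain ⟨s₁, t₁, e₁, ht₁, r₁⟩ := Cmd.exec_compile inp (n * n) (p := fun r => r == 0) (X := n)
    buildCover r₀ rfl (by
      intro r hr
      obtain rfl : r = 0 := by simpa using hr
      exact le_rfl)
  obtain ⟨hrows, C, hmarks, hcard, hC, hm⟩ :=
    den_buildCover (n := n) (σ := σ₀) rfl rfl rfl (fun _ => rfl) hG
  set σ₁ := buildCover.den inp σ₀ with hσ₁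
  set m := σ₁.reg 1 with hm_def
  obtain ⟨s₂, t₂, e₂, ht₂, r₂⟩ := Cmd.exec_compile inp (n * n) (p := fun r => r == 1) (X := m)
    (countCodes D) r₁
    (by simp [countCodes, Cmd.wf, noWrite_doublings, wf_doublings])
    (by
      intro r hr
      obtain rfl : r = 1 := by simpa using hr
      exact le_rfl)
  have hP : ((countCodes D).den inp σ₁).reg 2 = 2 ^ (m * D) := den_countCodes D σ₁
  have hsize : ((countCodes D).den inp σ₁).reg 0 = n := by
    rw [Cmd.den_reg inp (noWrite_countCodes D (by decide) (by decide)), hrows.size]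
  have hready : Ready C (2 ^ (m * D)) ((countCodes D).den inp σ₁) := by
    refine ⟨hrows.congr (by rw [hsize, hrows.size])
      (Cmd.den_arr inp (noStore_countCodes D _) _), ?_, hP⟩
    rw [Cmd.den_arr inp (noStore_countCodes D _)]
    exact hmarks
  have h15 : ((countCodes D).den inp σ₁).reg 15 = 0 := by
    rw [Cmd.den_reg inp (noWrite_countCodes D (by decide) (by decide)), hσ₁,
      Cmd.den_reg inp rfl]
    rfl
  set σ₂ := (countCodes D).den inp σ₁ with hσ₂
  obtain ⟨s₃, t₃, e₃, ht₃, r₃⟩ := Cmd.exec_compile inp (n * n) (p := fun r => r == 0 || r == 2)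
    (X := max n (2 ^ (m * D))) search r₂ rfl (by
      intro r hr
      have : r = 0 ∨ r = 2 := by simpa using hr
      rcases this with rfl | rfl
      · rw [hsize]
        exact le_max_left _ _
      · rw [hP]
        exact le_max_right _ _)
  obtain ⟨F, hF, hout, hbest⟩ := den_search hready hG hC (by positivity) h15
  obtain ⟨s₄, t₄, e₄, ht₄, hmem⟩ := exec_epilogue (n := n) r₃
    (by rw [Cmd.den_reg inp rfl, hsize]) (Nat.le_mul_self n)
  have hset : outputSet n s₄ = Fᶜ := by
    ext v
    rw [outputSet, Finset.mem_filter, hmem v v.2]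
    simpa using hout.ne_zero_iff v
  refine ⟨s₄, _, m, Exec.seq e₀ (Exec.seq e₁ (Exec.seq e₂ (Exec.seq e₃ e₄))), hm, ?_, ?_, ?_, ?_⟩
  · have := C.card_le_univ
    rw [Fintype.card_fin] at this
    omega
  · refine add_le_add ht₀ (add_le_add (ht₁.trans (Cmd.time_le _ _)) (add_le_add ?_
      (add_le_add (ht₃.trans (Cmd.time_le _ _)) ht₄)))
    refine ht₂.trans ?_
    simp only [countCodes, Cmd.time, time_doublings, AExpr.compile, Expr.cost]
    apply le_of_eq
    ring
  · rw [hset, isMinimalFVS_iff, compl_compl]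
    exact hF
  · rintro k rfl
    rw [hset]
    refine mul_opt_le_of_search hC (P := 2 ^ (m * (2 * (k + 2)))) ?_ hbest
    rw [hcard, show 2 * m * (k + 2) = m * (2 * (k + 2)) by ring]

/-! ### Running time and choice of constants -/

/-- Every summand is at most a constant times a power of `Y = (n + 2) * P`, where `75` generously
covers the linear terms. The constant factor is absorbed by `W ≤ 2 ^ W ≤ (n + 2) ^ W`, which is why
the base is `n + 2`. -/
theorem time_bound {W₁ W₃ d₁ d₃ n m D t : ℕ} (hm : m ≤ n)
    (ht : t ≤ (10 * n + 8) + (W₁ * (n + 1) ^ d₁ + ((8 + m * (4 * D + 9)) +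
      (W₃ * (max n (2 ^ (m * D)) + 1) ^ d₃ + (30 * n + 6))))) :
    t ≤ 2 ^ (m * D * (d₁ + d₃ + 1)) * (n + 2) ^ (W₁ + W₃ + 75 + (d₁ + d₃ + 1)) := by
  set P := 2 ^ (m * D) with hP
  set e := d₁ + d₃ + 1 with he
  have hP1 : 1 ≤ P := Nat.one_le_two_pow
  have hmD : m * D ≤ P := Nat.lt_two_pow_self.le
  set Y := (n + 2) * P with hY
  have hnY : n + 2 ≤ Y := Nat.le_mul_of_pos_right _ hP1
  have hPY : 2 * P ≤ Y := Nat.mul_le_mul_right P (by omega)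
  have hpow : ∀ {x d : ℕ}, x ≤ Y → d ≤ e → x ^ d ≤ Y ^ e := fun hx hd =>
    (Nat.pow_le_pow_left hx _).trans (Nat.pow_le_pow_right (by omega) hd)
  have h1 : W₁ * (n + 1) ^ d₁ ≤ W₁ * Y ^ e :=
    Nat.mul_le_mul_left _ (hpow (by omega) (by omega))
  have h3 : W₃ * (max n P + 1) ^ d₃ ≤ W₃ * Y ^ e :=
    Nat.mul_le_mul_left _ (hpow (by omega) (by omega))
  have hYe : Y ≤ Y ^ e := by
    simpa using Nat.pow_le_pow_right (show 0 < Y by omega) (show 1 ≤ e by omega)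
  have h2 : m * (4 * D + 9) ≤ 4 * P + 9 * n := by nlinarith
  have ht' : t ≤ (W₁ + W₃ + 75) * Y ^ e := by
    rw [add_mul, add_mul]
    omega
  calc t ≤ (W₁ + W₃ + 75) * Y ^ e := ht'
    _ ≤ (n + 2) ^ (W₁ + W₃ + 75) * Y ^ e := by
      refine Nat.mul_le_mul_right _ (Nat.lt_two_pow_self.le.trans ?_)
      exact Nat.pow_le_pow_left (by omega) _
    _ = _ := by
      rw [hY, hP, mul_pow, ← pow_mul, pow_add]
      ring

end MaxMinFVS

theorem theorem4 :
    ∃ c d : ℕ, ∀ ε : ℝ, 0 < ε → ∃ P : MaxMinFVS.Prog,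
      ∀ (n : ℕ) (G : SimpleGraph (Fin n)),
        ∃ (s : MaxMinFVS.State) (t : ℕ),
          MaxMinFVS.Exec P (MaxMinFVS.inputState G) s t ∧
          (t : ℝ) ≤ (2 : ℝ) ^ ((c : ℝ) * (MaxMinFVS.vc G : ℝ) / ε) * ((n : ℝ) + 2) ^ d ∧
          MaxMinFVS.IsMinimalFVS G (MaxMinFVS.outputSet n s) ∧
          (1 - ε) * (MaxMinFVS.opt G : ℝ) ≤ ((MaxMinFVS.outputSet n s).card : ℝ) := by
  set e := MaxMinFVS.buildCover.depth + MaxMinFVS.search.depth + 1 with he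
  refine ⟨8 * e, MaxMinFVS.buildCover.weight + MaxMinFVS.search.weight + 75 + e, ?_⟩
  intro ε hε
  set k := ⌈1 / ε⌉₊ with hk
  have hk1 : 1 / ε ≤ k := Nat.le_ceil _
  have hk2 : (k : ℝ) < 1 / ε + 1 := Nat.ceil_lt_add_one (by positivity)
  -- For `ε ≥ 1` any minimal feedback vertex set will do, and `D = 0` keeps the exponent within
  -- `O(vc G / ε)` even for large `ε`. For `ε < 1`, `2 * (k + 2) < 2 / ε + 6 < 8 / ε`.
  set D := if ε < 1 then 2 * (k + 2) else 0 with hD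
  have hDle : (D : ℝ) ≤ 8 / ε := by
    rw [hD]
    split_ifs with hε1
    · have : 1 < 1 / ε := (one_lt_div hε).2 hε1
      rw [show 8 / ε = 8 * (1 / ε) by ring]
      push_cast
      linarith
    · rw [Nat.cast_zero]
      positivity
  refine ⟨MaxMinFVS.maxMinFVSProg D, fun n G => ?_⟩
  obtain ⟨s, t, m, hexec, hm, hmn, ht, hmin, hopt⟩ := MaxMinFVS.exec_maxMinFVSProg D G
  refine ⟨s, t, hexec, ?_, hmin, ?_⟩
  · have h1 : (t : ℝ) ≤ 2 ^ (m * D * e) *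
        ((n : ℝ) + 2) ^ (MaxMinFVS.buildCover.weight + MaxMinFVS.search.weight + 75 + e) := by
      exact_mod_cast MaxMinFVS.time_bound hmn ht
    refine h1.trans (mul_le_mul_of_nonneg_right ?_ (by positivity))
    rw [← Real.rpow_natCast]
    refine Real.rpow_le_rpow_of_exponent_le (by norm_num) ?_
    have hm' : (m : ℝ) ≤ MaxMinFVS.vc G := by exact_mod_cast hm
    push_cast
    calc (m : ℝ) * D * e ≤ MaxMinFVS.vc G * (8 / ε) * e := by gcongr
      _ = _ := by ring
  · by_cases hε1 : ε < 1
    · have h := hopt k (by rw [hD, if_pos hε1])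
      have h' : (k : ℝ) * MaxMinFVS.opt G ≤
          k * (MaxMinFVS.outputSet n s).card + MaxMinFVS.opt G := by exact_mod_cast h
      set O : ℝ := ((MaxMinFVS.opt G : ℕ) : ℝ) with hO
      set S : ℝ := (((MaxMinFVS.outputSet n s).card : ℕ) : ℝ) with hS
      have hO0 : 0 ≤ O := Nat.cast_nonneg _
      by_cases hOS : O ≤ S
      · nlinarith
      -- The search gives `k * (O - S) ≤ O`, and `k ≥ 1 / ε` turns this into `O - S ≤ ε * O`.
      · have h2 : 1 / ε * (O - S) ≤ k * (O - S) :=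
          mul_le_mul_of_nonneg_right hk1 (by linarith)
        have h3 : 1 / ε * (O - S) ≤ O := by nlinarith
        have h4 : O - S ≤ ε * O := by
          calc O - S = ε * (1 / ε * (O - S)) := by field_simp
            _ ≤ ε * O := mul_le_mul_of_nonneg_left h3 hε.le
        linarith
    · have h1 : (1 - ε) * (MaxMinFVS.opt G : ℝ) ≤ 0 :=
        mul_nonpos_of_nonpos_of_nonneg (by linarith) (Nat.cast_nonneg _)
      exact h1.trans (Nat.cast_nonneg _)
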